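/- Notation. Fix $d,N\in\mathbb N$ and write $X=(x_1,\dots,x_N)\in\mathbb R^{Nd}$ with $x_i\in\mathbb R^d$. For $f\in H^1$ put $\|f\|_{H^1}^2=\int |f|^2+\int|\nabla f|^2$. Let $H$ be the set of functions $\rho\ge 0$ on $\mathbb R^d$ with $\int\rho=1$ and $\sqrt\rho\in H^1(\mathbb R^d)$. For $\rho\in H$ let $\Pi(\rho)$ be the set of Borel probability measures $P$ on $\mathbb R^{Nd}$ whose $N$ marginals on $\mathbb R^d$ all equal $\rho(x)\,dx$. For $\alpha>0$ let $D_\alpha=\{X:\ |x_i-x_j|<\alpha\ \text{for some } i\ne j\}$, and let $$C(P)=\int\sum_{1\le i<j\le N}\frac1{|x_i-x_j|}\,dP(X)\in[0,\infty],$$ where the integrand is $+\infty$ if $x_i=x_j$ for some $i\neq j$. Let $\eta(u)=k\,e^{-1/(1-|u|^2)}$ for $|u|<1$ and $\eta(u)=0$ for $|u|\ge1$ be the standard mollifier on $\mathbb R^d$, with $k=k(d)$ such that $\int\eta=1$, and let $\eta_\varepsilon(u)=\varepsilon^{-d}\eta(u/\varepsilon)$. Proposition. For every $d$ there is a constant $K=K(d)>0$,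 depending only on $d$, such that the following holds for all $N$. Let $\rho\in H$ and let $P\in\Pi(\rho)$ satisfy $P(D_\alpha)=0$ for some $\alpha>0$. Then there are a family of probability measures $(P_\varepsilon)_{\varepsilon>0}$ and functions $(\varphi_\varepsilon)_{\varepsilon>0}$ on $\mathbb R^{Nd}$ such that: (i) for every $\varepsilon>0$, $P_\varepsilon\in\Pi(\rho)$, $\varphi_\varepsilon\in H^1(\mathbb R^{Nd})$, and $P_\varepsilon$ is absolutely continuous with respect to Lebesgue measure with density $\varphi_\varepsilon^2$; (ii) $P_\varepsilon\rightharpoonup P$ as $\varepsilon\to0^+$, i.e. $\int\phi\,dP_\varepsilon\to\int\phi\,dP$ for every bounded continuous $\phi$; (iii) $\limsup_{\varepsilon\to0^+}C(P_\varepsilon)\le C(P)$; (iv) for every $\varepsilon>0$, $$\int|\nabla\varphi_\varepsilon(X)|^2\,dX\le N\Big(\|\sqrt\rho\|_{H^1}^2+\frac{K}{4\varepsilon^2}\Big).$$ Moreover, $P_\varepsilon$ can be taken to be the measure with density $$X\mapsto\int_{\mathbb R^{Nd}}\tilde P_\varepsilon(Y)\prod_{i=1}^N\gamma_\varepsilon(x_i,y_i)\,dY,$$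 where $\tilde P_\varepsilon(Y)=\int\prod_{i=1}^N\eta_\varepsilon(y_i-x_i)\,dP(X)$, $\gamma_\varepsilon(x,y)=\rho(x)\eta_\varepsilon(y-x)/\rho_\varepsilon(y)$ (read as $0$ where $\rho_\varepsilon(y)=0$), and $\rho_\varepsilon(y)=\int\rho(x)\eta_\varepsilon(y-x)\,dx$. -/

import Mathlib

open MeasureTheory Filter Topology
open scoped ENNReal ContDiff

noncomputable section

/-- The physical space `ℝ^d`, with its Euclidean norm and Lebesgue measure. -/
abbrev Space (d : ℕ) : Type := EuclideanSpace ℝ (Fin d)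

/-- The configuration space `ℝ^{Nd} = (ℝ^d)^N`, with its Euclidean norm and Lebesgue measure;
`X i : ℝ^d` is the position of the `i`-th particle. -/
abbrev Config (N d : ℕ) : Type := PiLp 2 (fun _ : Fin N => Space d)

section Sobolev

variable {V : Type*} [NormedAddCommGroup V] [InnerProductSpace ℝ V] [FiniteDimensional ℝ V]
  [MeasurableSpace V] [BorelSpace V]

/-- `G` is the weak (distributional) gradient of `f`:
`∫ f ∂_v ψ = - ∫ (G · v) ψ` for all directions `v` and all test functions `ψ ∈ C_c^∞(V)`. -/
structure HasWeakGradient (f : V → ℝ) (G : V → V) : Prop where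
  locallyIntegrable : LocallyIntegrable f volume
  locallyIntegrable_grad : LocallyIntegrable G volume
  integral_eq : ∀ ψ : V → ℝ, ContDiff ℝ ∞ ψ → HasCompactSupport ψ → ∀ v : V,
    ∫ x, f x * fderiv ℝ ψ x v = - ∫ x, inner ℝ (G x) v * ψ x

/-- Weak gradients are unique up to null sets. -/
theorem HasWeakGradient.ae_eq {f : V → ℝ} {G G' : V → V}
    (h : HasWeakGradient f G) (h' : HasWeakGradient f G') : G =ᵐ[volume] G' := by
  have key : ∀ᵐ x ∂(volume : Measure V), G x - G' x = 0 := by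
    refine ae_eq_zero_of_integral_contDiff_smul_eq_zero (f := fun x => G x - G' x)
      (h.locallyIntegrable_grad.sub h'.locallyIntegrable_grad) ?_
    intro ψ hψ hc
    have i1 : Integrable (fun x => ψ x • G x) volume :=
      h.locallyIntegrable_grad.integrable_smul_left_of_hasCompactSupport hψ.continuous hc
    have i2 : Integrable (fun x => ψ x • G' x) volume :=
      h'.locallyIntegrable_grad.integrable_smul_left_of_hasCompactSupport hψ.continuous hc
    simp only [smul_sub]
    rw [integral_sub i1 i2, sub_eq_zero]
    refine ext_inner_right ℝ fun v => ?_
    have e1 := h.integral_eq ψ hψ hc v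
    have e2 := h'.integral_eq ψ hψ hc v
    have s : ∀ F : V → V, Integrable (fun x => ψ x • F x) volume →
        inner ℝ (∫ x, ψ x • F x) v = ∫ x, inner ℝ (F x) v * ψ x := by
      intro F hF
      rw [real_inner_comm, ← integral_inner hF]
      refine integral_congr_ae (Eventually.of_forall fun x => ?_)
      simp only [inner_smul_right, real_inner_comm]
      ring
    rw [s G i1, s G' i2]
    linarith
  filter_upwards [key] with x hx using sub_eq_zero.mp hx

/-- The Sobolev space `H¹(V)`: square integrable functions with a square integrable
weak gradient. -/
def MemH1 (f : V → ℝ) : Prop :=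
  MemLp f 2 volume ∧ ∃ G : V → V, HasWeakGradient f G ∧ MemLp G 2 volume

open Classical in
/-- The weak gradient `∇f` (well defined up to null sets; `0` if there is none). -/
def weakGrad (f : V → ℝ) : V → V :=
  if h : ∃ G : V → V, HasWeakGradient f G then h.choose else 0

/-- The squared norm `‖f‖²_{H¹} = ∫ |f|² + ∫ |∇f|²` of `f ∈ H¹(V)`. -/
def h1NormSq (f : V → ℝ) : ℝ :=
  (∫ x, f x ^ 2) + ∫ x, ‖weakGrad f x‖ ^ 2

end Sobolev

/-- The class `H` of one-particle densities: `ρ ≥ 0`, `∫ ρ = 1`, `√ρ ∈ H¹(ℝ^d)`. -/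
structure IsElectronDensity {d : ℕ} (ρ : Space d → ℝ) : Prop where
  nonneg : 0 ≤ᵐ[volume] ρ
  integral_eq_one : ∫ x, ρ x = 1
  sqrt_memH1 : MemH1 (fun x => √(ρ x))

/-- The set `Π(ρ)` of transport plans: probability measures on `ℝ^{Nd}` all of whose `N`
one-particle marginals are `ρ(x) dx`. -/
def transportPlans (N : ℕ) {d : ℕ} (ρ : Space d → ℝ) : Set (ProbabilityMeasure (Config N d)) :=
  {P | ∀ i : Fin N, (P : Measure (Config N d)).map (fun X => X i) =
    volume.withDensity (fun x => ENNReal.ofReal (ρ x))}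

/-- The open strip `D_α` around the diagonals. -/
def diagStrip (N d : ℕ) (α : ℝ) : Set (Config N d) :=
  {X | ∃ i j : Fin N, i ≠ j ∧ ‖X i - X j‖ < α}

/-- The Coulomb cost `c(X) = ∑_{i<j} 1 / |x_i - x_j|`, equal to `∞` on the diagonals. -/
def coulombCost {N d : ℕ} (X : Config N d) : ℝ≥0∞ :=
  ∑ i : Fin N, ∑ j ∈ Finset.Ioi i, ‖X i - X j‖ₑ⁻¹

/-- The transport cost `C(P) = ∫ c dP ∈ [0, ∞]`. -/
def transportCost {N d : ℕ} (P : ProbabilityMeasure (Config N d)) : ℝ≥0∞ :=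
  ∫⁻ X, coulombCost X ∂(P : Measure (Config N d))

/-- The standard mollifier `η(u) = k exp(-1 / (1 - |u|²))` for `|u| < 1` and `η(u) = 0` for
`|u| ≥ 1`, with `k` such that `∫ η = 1`. -/
def stdMollifier (d : ℕ) (u : Space d) : ℝ :=
  (∫ v : Space d, expNegInvGlue (1 - ‖v‖ ^ 2))⁻¹ * expNegInvGlue (1 - ‖u‖ ^ 2)

/-- The rescaled mollifier `η_ε(u) = ε^{-d} η(u / ε)`. -/
def scaledMollifier (d : ℕ) (ε : ℝ) (u : Space d) : ℝ :=
  (ε ^ d)⁻¹ * stdMollifier d (ε⁻¹ • u)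

/-- The mollified density `ρ_ε = ρ * η_ε`. -/
def mollifiedDensity {d : ℕ} (ρ : Space d → ℝ) (ε : ℝ) (y : Space d) : ℝ≥0∞ :=
  ∫⁻ x, ENNReal.ofReal (ρ x) * ENNReal.ofReal (scaledMollifier d ε (y - x))

/-- The density `P̃_ε(Y) = ∫ ∏_i η_ε(y_i - x_i) dP(X)` of the mollified plan. -/
def mollifiedPlanDensity {N d : ℕ} (P : ProbabilityMeasure (Config N d)) (ε : ℝ)
    (Y : Config N d) : ℝ≥0∞ :=
  ∫⁻ X, ∏ i, ENNReal.ofReal (scaledMollifier d ε (Y i - X i)) ∂(P : Measure (Config N d))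

open Classical in
/-- The kernel `γ_ε(x, y) = ρ(x) η_ε(y - x) / ρ_ε(y)`, equal to `0` where `ρ_ε(y) = 0`. -/
def recompositionKernel {d : ℕ} (ρ : Space d → ℝ) (ε : ℝ) (x y : Space d) : ℝ≥0∞ :=
  if mollifiedDensity ρ ε y = 0 then 0 else
    ENNReal.ofReal (ρ x) * ENNReal.ofReal (scaledMollifier d ε (y - x)) / mollifiedDensity ρ ε y

/-- The density `X ↦ ∫ P̃_ε(Y) ∏_i γ_ε(x_i, y_i) dY` of the recomposed plan. -/
def recomposedPlanDensity {N d : ℕ} (ρ : Space d → ℝ) (P : ProbabilityMeasure (Config N d))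
    (ε : ℝ) (X : Config N d) : ℝ≥0∞ :=
  ∫⁻ Y : Config N d, mollifiedPlanDensity P ε Y * ∏ i, recompositionKernel ρ ε (X i) (Y i)

end

/-! Mollification moves the particles of a `P`-configuration independently with density η_ε, so
every marginal of P̃_ε is ρ_ε. Given Y, recomposition draws each x_i independently from γ_ε(·, y_i),
which sends ρ_ε back to ρ. Both moves are shorter than ε, so each particle travels less than 2ε
(`lintegral_recomposedPlanDensity_mul_le`). Tested on indicators, this bounds the new mass of a
closed set by the old mass of a thickening, whence weak convergence. Off D_α it shrinks each
distance by a factor no smaller than 1 - 4ε/α, which controls the cost.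

For the energy, the new density factorises as R(X)² h(X), with R = ∏ √ρ(x_i), h(X) = ∫ g(Y) T(X -
Y)² dY, T = ∏ √η_ε and g(Y) = P̃_ε(Y) / ∏ ρ_ε(y_i) (`recomposedPlanDensity_eq`). Thus φ = R √h and
formally ∇φ = h^(-1/2) ∫ g T (T ∇R + R ∇T) dY. Cauchy–Schwarz with weight g gives |∇φ|² ≤ ∫ g |T ∇R
+ R ∇T|² dY (`enorm_gradMulSqrtConv_sq_le`). The right side is a sum over i of products over the
particles. After integration in X each particle j ≠ i contributes at most ρ_ε(y_j) / ρ_ε(y_j) ≤ 1,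
and the i-th marginal of P̃_ε cancels the remaining 1 / ρ_ε(y_i)
(`lintegral_recomposition_apply_le`). What remains is N ∫∫ |√η_ε ∇√ρ + √ρ ∇√η_ε|², whose cross term
vanishes because η is even (`lintegral_norm_localization_sq`). The total is N (∫ |∇√ρ|² + ε⁻² ∫
|∇√η|²).

The formal gradient needs a proof, since g is not known to be locally integrable and the square root
is singular at 0. `hasWeakGradient_mul_sqrt_sqConv` truncates g, shifts the radicand by δ² and
passes to the limit by dominated convergence. The same Cauchy–Schwarz inequality makes the
domination uniform, and the energy estimate with ∇R or ∇T replaced by 0 makes the dominating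
functions locally integrable. -/

set_option linter.unusedSectionVars false

/-! ### Product structure of the volume on configuration space -/

namespace Config

variable {N d : ℕ}

theorem lintegral_fin_pi_prod {E : Type*} [MeasureSpace E] [SigmaFinite (volume : Measure E)] :
    ∀ {n : ℕ} {f : Fin n → E → ℝ≥0∞}, (∀ i, Measurable (f i)) →
      ∫⁻ x : Fin n → E, ∏ i, f i (x i) = ∏ i, ∫⁻ x, f i x
  | 0, f, _ => by simp [lintegral_const, volume_pi]
  | n + 1, f, hf => by
    rw [← ((volume_preserving_piFinSuccAbove (fun _ : Fin (n + 1) => E) 0).symm).lintegral_comp_emb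
      (MeasurableEquiv.measurableEmbedding _)]
    simp only [MeasurableEquiv.piFinSuccAbove_symm_apply, Fin.insertNthEquiv, Equiv.coe_fn_mk,
      Fin.insertNth_zero', Fin.prod_univ_succ, Fin.cons_zero, Fin.cons_succ]
    rw [← lintegral_fin_pi_prod (fun i : Fin n => hf i.succ), Measure.volume_eq_prod]
    exact lintegral_prod_mul (hf 0).aemeasurable
      (Finset.measurable_prod _ fun (i : Fin n) _ => (hf i.succ).comp (measurable_pi_apply i)).aemeasurable

/-- The identification of `Config N d` with the product `(ℝ^d)^N` preserves volume. -/
theorem volume_preserving_toLp :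
    MeasurePreserving (MeasurableEquiv.toLp 2 (Fin N → Space d)) := by
  refine ⟨(MeasurableEquiv.toLp 2 (Fin N → Space d)).measurable, ?_⟩
  -- A Haar measure is determined by its value on one parallelepiped. That of the product basis is a
  -- product of unit cubes, of volume 1.
  let b := Pi.orthonormalBasis (fun _ : Fin N => EuclideanSpace.basisFun (Fin d) ℝ)
  rw [← b.addHaar_eq_volume, eq_comm]
  have hH : ((volume : Measure (Fin N → Space d)).map
      (MeasurableEquiv.toLp 2 (Fin N → Space d))).IsAddHaarMeasure :=
    (PiLp.continuousLinearEquiv 2 ℝ (fun _ : Fin N => Space d)).symm.isAddHaarMeasure_map volume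
  rw [Module.Basis.addHaar_eq_iff, MeasurableEquiv.map_apply]
  have : (MeasurableEquiv.toLp 2 (Fin N → Space d)) ⁻¹' (b.toBasis.parallelepiped : Set (Config N d))
      = Set.univ.pi fun _ => parallelepiped (EuclideanSpace.basisFun (Fin d) ℝ) := by
    ext x
    have h1 := parallelepiped_basis_eq b.toBasis
    have h2 := parallelepiped_basis_eq (EuclideanSpace.basisFun (Fin d) ℝ).toBasis
    simp only [OrthonormalBasis.coe_toBasis] at h1 h2
    simp only [Set.mem_preimage, Module.Basis.coe_parallelepiped, OrthonormalBasis.coe_toBasis, h1, h2,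
      Set.mem_pi, Set.mem_ofPred_eq, Set.mem_univ, true_imp_iff, OrthonormalBasis.coe_toBasis_repr_apply]
    constructor
    · intro h i j
      exact h ⟨i, j⟩
    · intro h ij
      exact h ij.1 ij.2
  rw [this, volume_pi_pi]
  simp [OrthonormalBasis.volume_parallelepiped]

theorem lintegral_prod {f : Fin N → Space d → ℝ≥0∞} (hf : ∀ i, Measurable (f i)) :
    ∫⁻ X : Config N d, ∏ i, f i (X i) = ∏ i, ∫⁻ x, f i x := by
  rw [← lintegral_fin_pi_prod hf, ← volume_preserving_toLp.lintegral_comp_emb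
    (MeasurableEquiv.measurableEmbedding _)]
  rfl

theorem measurable_apply (i : Fin N) : Measurable fun X : Config N d => X i :=
  (PiLp.continuous_apply 2 _ i).measurable

/-- Null sets of one-particle space pull back to null sets; this is how almost everywhere statements
about ρ and ∇√ρ pass to configurations. -/
theorem quasiMeasurePreserving_apply (i : Fin N) :
    Measure.QuasiMeasurePreserving (fun X : Config N d => X i) := by
  have h := (Measure.quasiMeasurePreserving_eval (fun _ : Fin N => (volume : Measure (Space d))) i).comp
    (volume_preserving_toLp (N := N) (d := d)).symm.quasiMeasurePreserving
  exact h

end Config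

/-! ### Calculus of weak gradients and a weighted Cauchy–Schwarz inequality -/

section

variable {V : Type*} [NormedAddCommGroup V] [InnerProductSpace ℝ V] [FiniteDimensional ℝ V]
  [MeasurableSpace V] [BorelSpace V]

theorem HasWeakGradient.congr {f f' : V → ℝ} {G G' : V → V} (h : HasWeakGradient f G)
    (hf : f =ᵐ[volume] f') (hG : G =ᵐ[volume] G') : HasWeakGradient f' G' where
  locallyIntegrable := h.locallyIntegrable.congr hf
  locallyIntegrable_grad := h.locallyIntegrable_grad.congr hG
  integral_eq ψ hψ hc v := by
    have e1 : ∫ x, f' x * fderiv ℝ ψ x v = ∫ x, f x * fderiv ℝ ψ x v :=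
      integral_congr_ae (by filter_upwards [hf] with x hx; rw [hx])
    have e2 : ∫ x, inner ℝ (G' x) v * ψ x = ∫ x, inner ℝ (G x) v * ψ x :=
      integral_congr_ae (by filter_upwards [hG] with x hx; rw [hx])
    rw [e1, e2, h.integral_eq ψ hψ hc v]

theorem MeasureTheory.LocallyIntegrable.inner_const' {G : V → V} (h : LocallyIntegrable G volume)
    (v : V) : LocallyIntegrable (fun x => inner ℝ (G x) v) volume :=
  fun x => by
    obtain ⟨s, hs, hi⟩ := h x
    exact ⟨s, hs, hi.inner_const v⟩

theorem MeasureTheory.LocallyIntegrable.integrable_mul_of_hasCompactSupport {f ψ : V → ℝ}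
    (h : LocallyIntegrable f volume) (hψ : Continuous ψ) (hc : HasCompactSupport ψ) :
    Integrable (fun x => f x * ψ x) volume :=
  h.integrable_smul_right_of_hasCompactSupport hψ hc

/-- Product rule for a weakly differentiable and a smooth function. -/
theorem HasWeakGradient.mul_contDiff {f s : V → ℝ} {G s' : V → V} (h : HasWeakGradient f G)
    (hs : ContDiff ℝ ∞ s) (hs' : ∀ x, HasGradientAt s (s' x) x) :
    HasWeakGradient (fun x => f x * s x) (fun x => s x • G x + f x • s' x) := by
  have hd : ∀ x v, fderiv ℝ s x v = inner ℝ (s' x) v := fun x v => by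
    rw [(hs' x).hasFDerivAt.fderiv]; simp
  have hs'c : Continuous s' := by
    have : s' = fun x => (InnerProductSpace.toDual ℝ V).symm (fderiv ℝ s x) := by
      ext1 x; rw [(hs' x).hasFDerivAt.fderiv]; simp
    rw [this]
    exact (InnerProductSpace.toDual ℝ V).symm.continuous.comp (hs.continuous_fderiv (by simp))
  have l2 : LocallyIntegrable (fun x => s x • G x) volume :=
    h.locallyIntegrable_grad.continuous_smul hs.continuous
  have l3 : LocallyIntegrable (fun x => f x • s' x) volume :=
    h.locallyIntegrable.smul_continuous hs'c
  refine ⟨h.locallyIntegrable.mul_continuous hs.continuous, l2.add l3, fun ψ hψ hc v => ?_⟩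
  -- The product sψ is again a test function; the term of its derivative that falls on s becomes the
  -- second summand of the new gradient.
  have e := h.integral_eq (fun x => s x * ψ x) (hs.mul hψ) hc.mul_left v
  have hψd : Differentiable ℝ ψ := hψ.differentiable (by simp)
  have hsd : Differentiable ℝ s := hs.differentiable (by simp)
  have hcd : HasCompactSupport fun x => fderiv ℝ ψ x v := hc.fderiv_apply (𝕜 := ℝ) v
  have hψc : Continuous fun x => fderiv ℝ ψ x v :=
    (hψ.continuous_fderiv (by simp)).clm_apply continuous_const
  have e1 : ∀ x, f x * fderiv ℝ (fun x => s x * ψ x) x v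
      = f x * s x * fderiv ℝ ψ x v + inner ℝ (f x • s' x) v * ψ x := fun x => by
    have : fderiv ℝ (fun x => s x * ψ x) x = s x • fderiv ℝ ψ x + ψ x • fderiv ℝ s x :=
      fderiv_mul (hsd x) (hψd x)
    rw [this]
    simp only [add_apply, smul_apply, smul_eq_mul, hd,
      real_inner_smul_left]
    ring
  simp only [e1] at e
  have i1 : Integrable (fun x => f x * s x * fderiv ℝ ψ x v) volume :=
    (h.locallyIntegrable.mul_continuous hs.continuous).integrable_mul_of_hasCompactSupport hψc hcd
  have i2 : Integrable (fun x => inner ℝ (f x • s' x) v * ψ x) volume :=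
    (l3.inner_const' v).integrable_mul_of_hasCompactSupport hψ.continuous hc
  have i3 : Integrable (fun x => inner ℝ (s x • G x) v * ψ x) volume :=
    (l2.inner_const' v).integrable_mul_of_hasCompactSupport hψ.continuous hc
  rw [integral_add i1 i2] at e
  simp only [inner_add_left, add_mul]
  rw [integral_add i3 i2]
  have e2 : ∫ x, inner ℝ (G x) v * (s x * ψ x) = ∫ x, inner ℝ (s x • G x) v * ψ x := by
    congr 1; ext x; rw [real_inner_smul_left]; ring
  rw [e2] at e
  linarith

/-- Weak gradients are stable under dominated almost everywhere convergence. -/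
theorem HasWeakGradient.of_tendsto {fn : ℕ → V → ℝ} {Gn : ℕ → V → V} {f F D : V → ℝ} {G : V → V}
    (h : ∀ n, HasWeakGradient (fn n) (Gn n)) (hF : LocallyIntegrable F volume)
    (hD : LocallyIntegrable D volume) (hfF : ∀ n, ∀ᵐ x, |fn n x| ≤ F x)
    (hGD : ∀ n, ∀ᵐ x, ‖Gn n x‖ ≤ D x)
    (hf : ∀ᵐ x, Tendsto (fun n => fn n x) atTop (𝓝 (f x)))
    (hG : ∀ᵐ x, Tendsto (fun n => Gn n x) atTop (𝓝 (G x))) : HasWeakGradient f G := by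
  refine ⟨hF.mono (aestronglyMeasurable_of_tendsto_ae atTop
      (fun n => (h n).locallyIntegrable.aestronglyMeasurable) hf) ?_,
    hD.mono (aestronglyMeasurable_of_tendsto_ae atTop
      (fun n => (h n).locallyIntegrable_grad.aestronglyMeasurable) hG) ?_, fun ψ hψ hc v => ?_⟩
  · filter_upwards [hf, ae_all_iff.2 hfF] with x h1 h2
    exact (le_of_tendsto h1.abs (Eventually.of_forall h2)).trans (le_abs_self _)
  · filter_upwards [hG, ae_all_iff.2 hGD] with x h1 h2
    exact (le_of_tendsto h1.norm (Eventually.of_forall h2)).trans (le_abs_self _)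
  · have hcd : HasCompactSupport fun x => fderiv ℝ ψ x v := hc.fderiv_apply (𝕜 := ℝ) v
    have hψc : Continuous fun x => fderiv ℝ ψ x v :=
      (hψ.continuous_fderiv (by simp)).clm_apply continuous_const
    have t1 : Tendsto (fun n => ∫ x, fn n x * fderiv ℝ ψ x v) atTop
        (𝓝 (∫ x, f x * fderiv ℝ ψ x v)) := by
      refine tendsto_integral_of_dominated_convergence (fun x => F x * |fderiv ℝ ψ x v|)
        (fun n => (h n).locallyIntegrable.aestronglyMeasurable.mul hψc.aestronglyMeasurable)
        (hF.integrable_mul_of_hasCompactSupport hψc.abs hcd.norm) (fun n => ?_) ?_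
      · filter_upwards [hfF n] with x hx
        rw [Real.norm_eq_abs, abs_mul]
        gcongr
      · filter_upwards [hf] with x hx using hx.mul_const _
    have t2 : Tendsto (fun n => ∫ x, inner ℝ (Gn n x) v * ψ x) atTop
        (𝓝 (∫ x, inner ℝ (G x) v * ψ x)) := by
      refine tendsto_integral_of_dominated_convergence (fun x => ‖v‖ * (D x * |ψ x|))
        (fun n => ((h n).locallyIntegrable_grad.inner_const' v).aestronglyMeasurable.mul
          hψ.continuous.aestronglyMeasurable)
        ((hD.integrable_mul_of_hasCompactSupport hψ.continuous.abs hc.norm).const_mul _)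
        (fun n => ?_) ?_
      · filter_upwards [hGD n] with x hx
        rw [Real.norm_eq_abs, abs_mul]
        calc |inner ℝ (Gn n x) v| * |ψ x| ≤ (‖Gn n x‖ * ‖v‖) * |ψ x| := by
              gcongr; exact abs_real_inner_le_norm _ _
          _ ≤ (D x * ‖v‖) * |ψ x| := by gcongr
          _ = _ := by ring
      · filter_upwards [hG] with x hx using (hx.inner tendsto_const_nhds).mul_const _
    refine tendsto_nhds_unique t1 ?_
    simp only [(h _).integral_eq ψ hψ hc v]
    exact t2.neg

/-- Cauchy–Schwarz after splitting the weight as √g · √g. It serves both for the uniform domination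
in the limit argument and for the pointwise energy bound. -/
theorem norm_integral_mul_smul_le {α E : Type*} [MeasurableSpace α] {μ : Measure α}
    [NormedAddCommGroup E] [NormedSpace ℝ E] {g a : α → ℝ} {b : α → E}
    (hg : ∀ y, 0 ≤ g y) (hgm : AEStronglyMeasurable g μ)
    (ham : AEStronglyMeasurable a μ) (hbm : AEStronglyMeasurable b μ)
    (ha : Integrable (fun y => g y * a y ^ 2) μ) (hb : Integrable (fun y => g y * ‖b y‖ ^ 2) μ) :
    Integrable (fun y => (g y * a y) • b y) μ ∧
    ‖∫ y, (g y * a y) • b y ∂μ‖ ≤ √(∫ y, g y * a y ^ 2 ∂μ) * √(∫ y, g y * ‖b y‖ ^ 2 ∂μ) := by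
  have hsq : ∀ y, √(g y) ^ 2 = g y := fun y => Real.sq_sqrt (hg y)
  have hgs : AEStronglyMeasurable (fun y => √(g y)) μ :=
    Real.continuous_sqrt.comp_aestronglyMeasurable hgm
  have m1 : MemLp (fun y => √(g y) * |a y|) 2 μ := by
    refine (memLp_two_iff_integrable_sq (hgs.mul ham.norm)).2 ?_
    simpa [mul_pow, hsq] using ha
  have m2 : MemLp (fun y => √(g y) * ‖b y‖) 2 μ := by
    refine (memLp_two_iff_integrable_sq (hgs.mul hbm.norm)).2 ?_
    simpa [mul_pow, hsq] using hb
  have hn : ∀ y, ‖(g y * a y) • b y‖ = (√(g y) * |a y|) * (√(g y) * ‖b y‖) := fun y => by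
    rw [norm_smul, Real.norm_eq_abs, abs_mul, abs_of_nonneg (hg y)]
    calc _ = √(g y) ^ 2 * |a y| * ‖b y‖ := by rw [hsq]
      _ = _ := by ring
  have hi : Integrable (fun y => (g y * a y) • b y) μ := by
    refine (integrable_norm_iff ((hgm.mul ham).smul hbm)).1 ?_
    exact (m1.integrable_mul m2).congr (Eventually.of_forall fun y => (hn y).symm)
  refine ⟨hi, (norm_integral_le_integral_norm _).trans ?_⟩
  simp only [hn]
  have := integral_mul_le_Lp_mul_Lq_of_nonneg (μ := μ) (p := 2) (q := 2) Real.HolderConjugate.two_two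
    (f := fun y => √(g y) * |a y|) (g := fun y => √(g y) * ‖b y‖)
    (Eventually.of_forall fun y => by positivity) (Eventually.of_forall fun y => by positivity)
    (by simpa using m1) (by simpa using m2)
  refine this.trans (le_of_eq ?_)
  simp only [Real.rpow_two, mul_pow, hsq, sq_abs, ← Real.sqrt_eq_rpow]

end

/-! ### Truncated weights and convolution with the square of a bump -/

section

variable {V : Type*} [NormedAddCommGroup V] [InnerProductSpace ℝ V] [FiniteDimensional ℝ V]
  [MeasurableSpace V] [BorelSpace V]

/-- The weighted convolution `X ↦ ∫ g(Y) ‖B(X - Y)‖² dY`. -/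
noncomputable def sqConv {E : Type*} [NormedAddCommGroup E] (g : V → ℝ) (B : V → E) (X : V) : ℝ≥0∞ :=
  ∫⁻ Y, ENNReal.ofReal (g Y * ‖B (X - Y)‖ ^ 2)

theorem measurable_sqConv {E : Type*} [NormedAddCommGroup E] {g : V → ℝ} {B : V → E}
    (hg : Measurable g) (hB : Continuous B) : Measurable (sqConv g B) := by
  have : Measurable fun p : V × V => ENNReal.ofReal (g p.2 * ‖B (p.1 - p.2)‖ ^ 2) :=
    ((hg.comp measurable_snd).mul
      ((hB.comp (continuous_fst.sub continuous_snd)).norm.pow 2).measurable).ennreal_ofReal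
  exact this.lintegral_prod_right'

theorem integrable_of_sqConv {E : Type*} [NormedAddCommGroup E] {g : V → ℝ} {B : V → E}
    (hg : Measurable g) (hg0 : ∀ y, 0 ≤ g y) (hB : Continuous B) {X : V} (h : sqConv g B X ≠ ⊤) :
    Integrable (fun Y => g Y * ‖B (X - Y)‖ ^ 2) ∧
      (sqConv g B X).toReal = ∫ Y, g Y * ‖B (X - Y)‖ ^ 2 := by
  have hm : AEStronglyMeasurable (fun Y => g Y * ‖B (X - Y)‖ ^ 2) volume :=
    hg.aestronglyMeasurable.mul (by fun_prop : Continuous fun Y => ‖B (X - Y)‖ ^ 2).aestronglyMeasurable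
  have h0 : 0 ≤ᵐ[volume] (fun Y => g Y * ‖B (X - Y)‖ ^ 2) :=
    Eventually.of_forall fun Y => mul_nonneg (hg0 Y) (by positivity)
  exact ⟨(lintegral_ofReal_ne_top_iff_integrable hm h0).1 h,
    (integral_eq_lintegral_of_nonneg_ae h0 hm).symm⟩

/-- The truncation of `g` to height `m` on the ball of radius `m`. -/
noncomputable def ballTrunc (g : V → ℝ) (m : ℕ) : V → ℝ :=
  (Metric.closedBall (0 : V) m).indicator fun y => min (g y) m

section ballTrunc

variable {g : V → ℝ}

theorem ballTrunc_nonneg (hg0 : ∀ y, 0 ≤ g y) (m : ℕ) (y : V) : 0 ≤ ballTrunc g m y :=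
  Set.indicator_nonneg (fun y _ => le_min (hg0 y) (Nat.cast_nonneg m)) y

theorem ballTrunc_le (hg0 : ∀ y, 0 ≤ g y) (m : ℕ) (y : V) : ballTrunc g m y ≤ g y := by
  unfold ballTrunc
  by_cases h : y ∈ Metric.closedBall (0 : V) m <;> simp [h, hg0 y]

theorem measurable_ballTrunc (hg : Measurable g) (m : ℕ) : Measurable (ballTrunc g m) :=
  (hg.min measurable_const).indicator Metric.isClosed_closedBall.measurableSet

theorem integrable_ballTrunc (hg : Measurable g) (hg0 : ∀ y, 0 ≤ g y) (m : ℕ) : Integrable (ballTrunc g m) := by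
  have : Integrable ((Metric.closedBall (0 : V) m).indicator fun _ => (m : ℝ)) :=
    (integrable_indicator_iff Metric.isClosed_closedBall.measurableSet).2
      (integrableOn_const (isCompact_closedBall _ _).measure_lt_top.ne)
  refine this.mono' (measurable_ballTrunc hg m).aestronglyMeasurable (Eventually.of_forall fun y => ?_)
  rw [Real.norm_of_nonneg (ballTrunc_nonneg hg0 m y)]
  exact Set.indicator_le_indicator (min_le_right _ _)

theorem tendsto_ballTrunc (y : V) : Tendsto (fun m => ballTrunc g m y) atTop (𝓝 (g y)) := by
  -- The sequence is eventually constant: the truncation is inactive once m exceeds both ‖y‖ and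
  -- g(y).
  refine tendsto_const_nhds.congr' ?_
  obtain ⟨k, hk⟩ := exists_nat_ge (max ‖y‖ (g y))
  filter_upwards [eventually_ge_atTop k] with m hm
  have h1 : max ‖y‖ (g y) ≤ m := hk.trans (by exact_mod_cast hm)
  have h2 : y ∈ Metric.closedBall (0 : V) m := by
    simpa using (le_max_left _ _).trans h1
  rw [ballTrunc, Set.indicator_of_mem h2, min_eq_left ((le_max_right _ _).trans h1)]

end ballTrunc

theorem continuous_gradient {T : V → ℝ} {T' : V → V} (hT : ContDiff ℝ ∞ T)
    (hT' : ∀ x, HasGradientAt T (T' x) x) : Continuous T' := by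
  have : T' = fun x => (InnerProductSpace.toDual ℝ V).symm (fderiv ℝ T x) := by
    ext1 x; rw [(hT' x).hasFDerivAt.fderiv]; simp
  rw [this]
  exact (InnerProductSpace.toDual ℝ V).symm.continuous.comp (hT.continuous_fderiv (by simp))

theorem hasCompactSupport_gradient {T : V → ℝ} {T' : V → V} (hTc : HasCompactSupport T)
    (hT' : ∀ x, HasGradientAt T (T' x) x) : HasCompactSupport T' := by
  have : T' = fun x => (InnerProductSpace.toDual ℝ V).symm (fderiv ℝ T x) := by
    ext1 x; rw [(hT' x).hasFDerivAt.fderiv]; simp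
  rw [this]
  exact (hTc.fderiv ℝ).comp_left (g := (InnerProductSpace.toDual ℝ V).symm) (map_zero _)

theorem HasCompactSupport.comp_sub_left {E : Type*} [Zero E] {B : V → E} (hB : HasCompactSupport B)
    (X : V) : HasCompactSupport fun Y => B (X - Y) :=
  hB.comp_homeomorph (Homeomorph.subLeft X)

theorem integrable_mul_normSq_sub {E : Type*} [NormedAddCommGroup E] {g : V → ℝ} {B : V → E}
    (hg : Integrable g) (hB : Continuous B) (hBc : HasCompactSupport B) (X : V) :
    Integrable fun Y => g Y * ‖B (X - Y)‖ ^ 2 :=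
  hg.locallyIntegrable.integrable_mul_of_hasCompactSupport (by fun_prop)
    (((hBc.comp_left (g := fun e => ‖e‖ ^ 2) (by simp))).comp_sub_left X)

/-- Convolution of an integrable function with the square of a smooth compactly supported one. -/
theorem hasGradientAt_integral_mul_sq {T : V → ℝ} {T' : V → V} (hT : ContDiff ℝ ∞ T)
    (hTc : HasCompactSupport T) (hT' : ∀ x, HasGradientAt T (T' x) x) {g : V → ℝ}
    (hg : Integrable g) :
    ContDiff ℝ ∞ (fun X => ∫ Y, g Y * ‖T (X - Y)‖ ^ 2) ∧
      ∀ X, HasGradientAt (fun X => ∫ Y, g Y * ‖T (X - Y)‖ ^ 2)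
        ((2 : ℝ) • ∫ Y, (g Y * T (X - Y)) • T' (X - Y)) X := by
  -- Written as the convolution g ⋆ T², all derivatives fall on T², and only integrability of g is
  -- needed.
  have hc : (fun X => ∫ Y, g Y * ‖T (X - Y)‖ ^ 2)
      = convolution g (fun x => T x ^ 2) (ContinuousLinearMap.mul ℝ ℝ) volume := by
    ext X; simp [convolution]
  have hT2 : ContDiff ℝ ∞ fun x => T x ^ 2 := hT.pow 2
  have hT2c : HasCompactSupport fun x => T x ^ 2 := by
    exact hTc.comp_left (g := fun t : ℝ => t ^ 2) (by simp)
  have hT'c := continuous_gradient hT hT'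
  have hi : ∀ X, Integrable fun Y => (g Y * T (X - Y)) • T' (X - Y) := fun X => by
    simp only [mul_smul]
    refine hg.locallyIntegrable.integrable_smul_right_of_hasCompactSupport
      (g := fun Y => T (X - Y) • T' (X - Y)) (by have := hT.continuous; fun_prop) ?_
    exact (hTc.comp_sub_left X).smul_right
  rw [hc]
  refine ⟨hT2c.contDiff_convolution_right _ hg.locallyIntegrable hT2, fun X => ?_⟩
  rw [hasGradientAt_iff_hasFDerivAt]
  have := hT2c.hasFDerivAt_convolution_right (ContinuousLinearMap.mul ℝ ℝ) hg.locallyIntegrable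
    (hT2.of_le (by simp)) X
  refine this.congr_fderiv ?_
  have hint : Integrable fun Y => ((ContinuousLinearMap.mul ℝ ℝ).precompR V (g Y))
      (fderiv ℝ (fun x => T x ^ 2) (X - Y)) :=
    (hT2c.fderiv ℝ).convolutionExists_right _ hg.locallyIntegrable
      (hT2.continuous_fderiv (by simp)) X
  refine ContinuousLinearMap.ext fun v => ?_
  rw [convolution_def, ContinuousLinearMap.integral_apply hint]
  simp only [InnerProductSpace.toDual_apply_apply, real_inner_smul_left,
    ContinuousLinearMap.precompR_apply, ContinuousLinearMap.compL_apply,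
    ContinuousLinearMap.comp_apply, ContinuousLinearMap.mul_apply']
  rw [real_inner_comm, ← integral_inner (hi X), ← integral_const_mul]
  refine integral_congr_ae (Eventually.of_forall fun Y => ?_)
  have h2 : HasFDerivAt (fun x => T x ^ 2) _ (X - Y) := (hT' (X - Y)).hasFDerivAt.pow 2
  simp only [h2.fderiv, inner_smul_right]
  rw [real_inner_comm]
  simp
  ring

end

/-! ### The weak gradient of R √(g ⋆ T²) and its energy bound -/

section

variable {V : Type*} [NormedAddCommGroup V] [InnerProductSpace ℝ V] [FiniteDimensional ℝ V]
  [MeasurableSpace V] [BorelSpace V]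

theorem MeasureTheory.LocallyIntegrable.norm' {E : Type*} [NormedAddCommGroup E] {f : V → E}
    (h : LocallyIntegrable f volume) : LocallyIntegrable (fun x => ‖f x‖) volume := fun x => by
  obtain ⟨s, hs, hi⟩ := h x
  exact ⟨s, hs, hi.norm⟩

/-- The gradient of `R √h` for `h = ∫ g(Y) T(X - Y)² dY`, where `S`, `T'` are the gradients of
`R`, `T`. -/
noncomputable def gradMulSqrtConv (R : V → ℝ) (S : V → V) (g T : V → ℝ) (T' : V → V) (X : V) : V :=
  √(sqConv g T X).toReal • S X +
    (R X * (√(sqConv g T X).toReal)⁻¹) • ∫ Y, (g Y * T (X - Y)) • T' (X - Y)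

/-- The bound does not degenerate as s tends to 0. It is used with the regularised root s = √(h +
δ²) and with s = √h itself, where `0⁻¹ = 0` covers the zeros of h. -/
theorem norm_inv_smul_le {s h k : ℝ} {w : V} (hs : √h ≤ s) (hw : ‖w‖ ≤ √h * √k) :
    ‖s⁻¹ • w‖ ≤ √k := by
  have hs0 : 0 ≤ s := (Real.sqrt_nonneg _).trans hs
  rw [norm_smul, norm_inv, Real.norm_of_nonneg hs0]
  rcases hs0.eq_or_lt with h0 | h0
  · simp [← h0]
  · rw [inv_mul_le_iff₀ h0]
    exact hw.trans (by gcongr)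

/-- With g truncated and δ² added under the root, the second factor is smooth and the product rule
applies. Finiteness of the convolutions is required only where it matters: elsewhere the factor R or
S is zero. -/
theorem hasWeakGradient_mul_sqrt_sqConv {R : V → ℝ} {S : V → V} (hR : HasWeakGradient R S)
    {T : V → ℝ} {T' : V → V} (hT : ContDiff ℝ ∞ T) (hTc : HasCompactSupport T)
    (hT' : ∀ x, HasGradientAt T (T' x) x) {g : V → ℝ} (hg : Measurable g) (hg0 : ∀ y, 0 ≤ g y)
    (a1 : ∀ᵐ X, R X ≠ 0 → sqConv g T X ≠ ⊤) (a2 : ∀ᵐ X, S X ≠ 0 → sqConv g T X ≠ ⊤)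
    (a3 : ∀ᵐ X, R X ≠ 0 → sqConv g T' X ≠ ⊤)
    (i1 : LocallyIntegrable (fun X => ‖R X‖ * √(sqConv g T X).toReal))
    (i2 : LocallyIntegrable (fun X => ‖S X‖ * √(sqConv g T X).toReal))
    (i3 : LocallyIntegrable (fun X => ‖R X‖ * √(sqConv g T' X).toReal)) :
    HasWeakGradient (fun X => R X * √(sqConv g T X).toReal) (gradMulSqrtConv R S g T T') := by
  have hT'c := continuous_gradient hT hT'
  have hT's := hasCompactSupport_gradient hTc hT'
  set G := fun m : ℕ => ballTrunc g m
  have hGi : ∀ m, Integrable (G m) := fun m => integrable_ballTrunc hg hg0 m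
  have hGm : ∀ m, Measurable (G m) := fun m => measurable_ballTrunc hg m
  have hG0 : ∀ m y, 0 ≤ G m y := fun m => ballTrunc_nonneg hg0 m
  have hGle : ∀ m y, G m y ≤ g y := fun m => ballTrunc_le hg0 m
  set h := fun (m : ℕ) X => ∫ Y, G m Y * ‖T (X - Y)‖ ^ 2
  set k := fun (m : ℕ) X => ∫ Y, G m Y * ‖T' (X - Y)‖ ^ 2
  set w := fun (m : ℕ) X => ∫ Y, (G m Y * T (X - Y)) • T' (X - Y)
  -- The shift keeps the radicand positive, hence the root smooth. The bound δ ≤ 1 later gives s ≤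
  -- √h + 1 uniformly in m.
  set δ := fun m : ℕ => ((m : ℝ) + 1)⁻¹ with hδ
  have hδ0 : ∀ m, 0 < δ m := fun m => by positivity
  have hδ1 : ∀ m, δ m ≤ 1 := fun m => inv_le_one_of_one_le₀ (by simp)
  have hδt : Tendsto δ atTop (𝓝 0) := by
    simpa [hδ] using tendsto_one_div_add_atTop_nhds_zero_nat (𝕜 := ℝ)
  have hh0 : ∀ m X, 0 ≤ h m X := fun m X =>
    integral_nonneg fun Y => mul_nonneg (hG0 m Y) (by positivity)
  set s := fun (m : ℕ) X => √(h m X + δ m ^ 2) with hs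
  have hpos : ∀ m X, 0 < h m X + δ m ^ 2 := fun m X =>
    add_pos_of_nonneg_of_pos (hh0 m X) (by have := hδ0 m; positivity)
  have hs0 : ∀ m X, 0 < s m X := fun m X => Real.sqrt_pos.2 (hpos m X)
  have hgrad : ∀ m X, HasGradientAt (s m) ((s m X)⁻¹ • w m X) X := fun m X => by
    have h1 := (hasGradientAt_integral_mul_sq hT hTc hT' (hGi m)).2 X
    rw [hasGradientAt_iff_hasFDerivAt] at h1 ⊢
    refine ((h1.add_const (δ m ^ 2)).sqrt (hpos m X).ne').congr_fderiv ?_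
    rw [map_smul, map_smul, smul_smul]
    congr 1
    -- The factor 2 from differentiating T² cancels the 1/2 from differentiating the root.
    change 1 / (2 * s m X) * 2 = (s m X)⁻¹
    have := (hs0 m X).ne'
    field_simp
  have hwg : ∀ m, HasWeakGradient (fun X => R X * s m X)
      (fun X => s m X • S X + R X • ((s m X)⁻¹ • w m X)) := fun m =>
    hR.mul_contDiff
      (((hasGradientAt_integral_mul_sq hT hTc hT' (hGi m)).1.add contDiff_const).sqrt
        fun X => (hpos m X).ne') (hgrad m)
  have hw : ∀ m X, ‖w m X‖ ≤ √(h m X) * √(k m X) := fun m X => by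
    have := (norm_integral_mul_smul_le (μ := volume) (g := G m) (a := fun Y => T (X - Y))
      (b := fun Y => T' (X - Y)) (hG0 m) (hGm m).aestronglyMeasurable
      (by have := hT.continuous; fun_prop : Continuous fun Y => T (X - Y)).aestronglyMeasurable
      (by fun_prop : Continuous fun Y => T' (X - Y)).aestronglyMeasurable
      (by simpa using integrable_mul_normSq_sub (hGi m) hT.continuous hTc X)
      (integrable_mul_normSq_sub (hGi m) hT'c hT's X)).2
    simpa [h, k, w] using this
  have hsh : ∀ m X, √(h m X) ≤ s m X := fun m X => Real.sqrt_le_sqrt (by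
    have := hδ0 m; nlinarith [sq_nonneg (δ m)])
  have hsle : ∀ m X, s m X ≤ √(h m X) + 1 := fun m X => by
    refine Real.sqrt_le_iff.2 ⟨by positivity, ?_⟩
    have h1 := Real.sq_sqrt (hh0 m X)
    have h2 := Real.sqrt_nonneg (h m X)
    nlinarith [hδ0 m, hδ1 m]
  have hhle : ∀ m X, sqConv g T X ≠ ⊤ → h m X ≤ (sqConv g T X).toReal := fun m X hX => by
    obtain ⟨e1, e2⟩ := integrable_of_sqConv hg hg0 hT.continuous hX
    rw [e2]
    exact integral_mono (integrable_mul_normSq_sub (hGi m) hT.continuous hTc X) e1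
      fun Y => mul_le_mul_of_nonneg_right (hGle m Y) (by positivity)
  have hkle : ∀ m X, sqConv g T' X ≠ ⊤ → k m X ≤ (sqConv g T' X).toReal := fun m X hX => by
    obtain ⟨e1, e2⟩ := integrable_of_sqConv hg hg0 hT'c hX
    rw [e2]
    exact integral_mono (integrable_mul_normSq_sub (hGi m) hT'c hT's X) e1
      fun Y => mul_le_mul_of_nonneg_right (hGle m Y) (by positivity)
  have hht : ∀ X, sqConv g T X ≠ ⊤ → Tendsto (fun m => h m X) atTop (𝓝 (sqConv g T X).toReal) :=
    fun X hX => by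
      obtain ⟨e1, e2⟩ := integrable_of_sqConv hg hg0 hT.continuous hX
      rw [e2]
      refine tendsto_integral_of_dominated_convergence _
        (fun m => (integrable_mul_normSq_sub (hGi m) hT.continuous hTc X).aestronglyMeasurable) e1
        (fun m => Eventually.of_forall fun Y => ?_)
        (Eventually.of_forall fun Y => (tendsto_ballTrunc Y).mul_const _)
      rw [Real.norm_of_nonneg (mul_nonneg (hG0 m Y) (by positivity))]
      exact mul_le_mul_of_nonneg_right (hGle m Y) (by positivity)
  have hst : ∀ X, sqConv g T X ≠ ⊤ → Tendsto (fun m => s m X) atTop (𝓝 √(sqConv g T X).toReal) :=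
    fun X hX => by
      have := ((hht X hX).add (hδt.pow 2)).sqrt
      simpa using this
  have hwt : ∀ X, sqConv g T X ≠ ⊤ → sqConv g T' X ≠ ⊤ → Tendsto (fun m => w m X) atTop
      (𝓝 (∫ Y, (g Y * T (X - Y)) • T' (X - Y))) := fun X hX hX' => by
    have c1 : Continuous fun Y => T (X - Y) := by have := hT.continuous; fun_prop
    have c2 : Continuous fun Y => T' (X - Y) := by fun_prop
    have hi := (norm_integral_mul_smul_le (μ := volume) (g := g) (a := fun Y => T (X - Y))
      (b := fun Y => T' (X - Y)) hg0 hg.aestronglyMeasurable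
      c1.aestronglyMeasurable c2.aestronglyMeasurable
      (by simpa using (integrable_of_sqConv hg hg0 hT.continuous hX).1)
      (integrable_of_sqConv hg hg0 hT'c hX').1).1
    refine tendsto_integral_of_dominated_convergence _
      (fun m => ((hGm m).aestronglyMeasurable.mul c1.aestronglyMeasurable).smul
        c2.aestronglyMeasurable) hi.norm
      (fun m => Eventually.of_forall fun Y => ?_)
      (Eventually.of_forall fun Y => ((tendsto_ballTrunc Y).mul_const _).smul_const _)
    rw [norm_smul, norm_smul, norm_mul, norm_mul, Real.norm_of_nonneg (hG0 m Y),
      Real.norm_of_nonneg (hg0 Y)]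
    gcongr
    exact hGle m Y
  -- With H = g ⋆ T² and K = g ⋆ ‖T'‖², the functions are dominated by |R|√H + |R| and the gradients
  -- by ‖S‖√H + ‖S‖ + |R|√K. The last term comes from ‖w/s‖ ≤ √k, in which δ no longer appears.
  refine HasWeakGradient.of_tendsto hwg (i1.add hR.locallyIntegrable.norm')
    ((i2.add hR.locallyIntegrable_grad.norm').add i3)
    (fun m => ?_) (fun m => ?_) ?_ ?_
  · filter_upwards [a1] with X h1
    by_cases hRX : R X = 0
    · simp [hRX]
    · rw [abs_mul, abs_of_pos (hs0 m X)]
      have h2 := Real.sqrt_le_sqrt (hhle m X (h1 hRX))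
      calc |R X| * s m X ≤ |R X| * (√(sqConv g T X).toReal + 1) := by
            gcongr; linarith [hsle m X]
        _ = _ := by simp only [Pi.add_apply, Real.norm_eq_abs]; ring
  · filter_upwards [a2, a3] with X h2 h3
    refine (norm_add_le _ _).trans (add_le_add ?_ ?_)
    · by_cases hSX : S X = 0
      · simp [hSX]
      · rw [norm_smul, Real.norm_of_nonneg (hs0 m X).le]
        have h4 := Real.sqrt_le_sqrt (hhle m X (h2 hSX))
        calc s m X * ‖S X‖ ≤ (√(sqConv g T X).toReal + 1) * ‖S X‖ := by
              gcongr; linarith [hsle m X]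
          _ = _ := by simp only [Pi.add_apply]; ring
    · by_cases hRX : R X = 0
      · simp [hRX]
      · rw [norm_smul]
        refine mul_le_mul_of_nonneg_left ?_ (norm_nonneg _)
        exact (norm_inv_smul_le (hsh m X) (hw m X)).trans (Real.sqrt_le_sqrt (hkle m X (h3 hRX)))
  · filter_upwards [a1] with X h1
    by_cases hRX : R X = 0
    · simp [hRX]
    · exact (hst X (h1 hRX)).const_mul _
  · filter_upwards [a1, a2, a3] with X h1 h2 h3
    refine Tendsto.add ?_ ?_
    · by_cases hSX : S X = 0
      · simp [hSX]
      · exact (hst X (h2 hSX)).smul_const _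
    · by_cases hRX : R X = 0
      · simp [hRX]
      · rw [mul_smul (R X)]
        refine Tendsto.const_smul ?_ _
        -- Where H vanishes the roots tend to 0, but Cauchy–Schwarz forces every w to be 0, in
        -- agreement with the convention `0⁻¹ = 0` in the limit.
        by_cases hh : (sqConv g T X).toReal = 0
        · have : ∀ m, w m X = 0 := fun m => by
            have e : h m X = 0 := le_antisymm ((hhle m X (h1 hRX)).trans hh.le) (hh0 m X)
            have := hw m X
            rw [e] at this
            simpa using this
          simp [this, hh]
        · refine ((hst X (h1 hRX)).inv₀ ?_).smul (hwt X (h1 hRX) (h3 hRX))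
          rwa [Real.sqrt_ne_zero ENNReal.toReal_nonneg]

/-- The gradient equals H^(-1/2) ∫ g T (T S + R T') with H = ∫ g T², so Cauchy–Schwarz with weight g
cancels H. Keeping T S + R T' together inside the square is what lets the cross term cancel later.
-/
theorem enorm_gradMulSqrtConv_sq_le {R : V → ℝ} {S : V → V} {T : V → ℝ} {T' : V → V}
    (hT : Continuous T) (hT' : Continuous T') {g : V → ℝ} (hg : Measurable g)
    (hg0 : ∀ y, 0 ≤ g y) {X : V} (a1 : R X ≠ 0 → sqConv g T X ≠ ⊤)
    (a2 : S X ≠ 0 → sqConv g T X ≠ ⊤) (a3 : R X ≠ 0 → sqConv g T' X ≠ ⊤) :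
    ENNReal.ofReal (‖gradMulSqrtConv R S g T T' X‖ ^ 2) ≤
      ∫⁻ Y, ENNReal.ofReal (g Y * ‖T (X - Y) • S X + R X • T' (X - Y)‖ ^ 2) := by
  by_cases hRX : R X = 0
  · by_cases hSX : S X = 0
    · simp [gradMulSqrtConv, hRX, hSX]
    · have hH := a2 hSX
      simp only [gradMulSqrtConv, hRX, zero_mul, zero_smul, add_zero, norm_smul, mul_pow, sq_abs,
        Real.norm_eq_abs, Real.sq_sqrt ENNReal.toReal_nonneg]
      rw [ENNReal.ofReal_mul ENNReal.toReal_nonneg, ENNReal.ofReal_toReal hH, sqConv,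
        ← lintegral_mul_const' _ _ ENNReal.ofReal_ne_top]
      refine le_of_eq (lintegral_congr fun Y => ?_)
      rw [← ENNReal.ofReal_mul (mul_nonneg (hg0 Y) (by positivity))]
      congr 1
      simp only [Real.norm_eq_abs, sq_abs]
      ring
  · have hH := a1 hRX
    have hK := a3 hRX
    obtain ⟨e1, e2⟩ := integrable_of_sqConv hg hg0 hT hH
    obtain ⟨e3, -⟩ := integrable_of_sqConv hg hg0 hT' hK
    have c1 : Continuous fun Y => T (X - Y) := by fun_prop
    have c2 : Continuous fun Y => T' (X - Y) := by fun_prop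
    have c3 : Continuous fun Y => T (X - Y) • S X + R X • T' (X - Y) := by fun_prop
    have e4 : Integrable fun Y => g Y * ‖T (X - Y) • S X + R X • T' (X - Y)‖ ^ 2 := by
      -- Domination through ‖a + b‖² ≤ 2‖a‖² + 2‖b‖².
      refine ((e1.const_mul (2 * ‖S X‖ ^ 2)).add (e3.const_mul (2 * R X ^ 2))).mono'
        (hg.aestronglyMeasurable.mul (c3.norm.pow 2).aestronglyMeasurable)
        (Eventually.of_forall fun Y => ?_)
      rw [Real.norm_of_nonneg (mul_nonneg (hg0 Y) (by positivity))]
      have : ‖T (X - Y) • S X + R X • T' (X - Y)‖ ^ 2 ≤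
          2 * (‖T (X - Y)‖ ^ 2 * ‖S X‖ ^ 2 + R X ^ 2 * ‖T' (X - Y)‖ ^ 2) := by
        have h1 := norm_add_le (T (X - Y) • S X) (R X • T' (X - Y))
        have h2 : ‖T (X - Y) • S X‖ ^ 2 = ‖T (X - Y)‖ ^ 2 * ‖S X‖ ^ 2 := by
          rw [norm_smul, mul_pow]
        have h3 : ‖R X • T' (X - Y)‖ ^ 2 = R X ^ 2 * ‖T' (X - Y)‖ ^ 2 := by
          rw [norm_smul, mul_pow, Real.norm_eq_abs, sq_abs]
        rw [← h2, ← h3]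
        have h4 := pow_le_pow_left₀ (norm_nonneg _) h1 2
        nlinarith [sq_nonneg (‖T (X - Y) • S X‖ - ‖R X • T' (X - Y)‖)]
      have h5 := mul_le_mul_of_nonneg_left this (hg0 Y)
      simp only [Pi.add_apply]
      linarith
    obtain ⟨h5, h6⟩ := norm_integral_mul_smul_le (μ := volume) (g := g) (a := fun Y => T (X - Y))
      (b := fun Y => T (X - Y) • S X + R X • T' (X - Y)) hg0 hg.aestronglyMeasurable
      c1.aestronglyMeasurable c3.aestronglyMeasurable (by simpa using e1) e4
    have h7 := (norm_integral_mul_smul_le (μ := volume) (g := g) (a := fun Y => T (X - Y))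
      (b := fun Y => T' (X - Y)) hg0 hg.aestronglyMeasurable
      c1.aestronglyMeasurable c2.aestronglyMeasurable (by simpa using e1) e3).1
    rw [← ofReal_integral_eq_lintegral_ofReal e4
      (Eventually.of_forall fun Y => mul_nonneg (hg0 Y) (by positivity))]
    apply ENNReal.ofReal_le_ofReal
    have h8 : ∫ Y, (g Y * T (X - Y)) • (T (X - Y) • S X + R X • T' (X - Y)) =
        (sqConv g T X).toReal • S X + R X • ∫ Y, (g Y * T (X - Y)) • T' (X - Y) := by
      rw [e2, ← integral_smul_const, ← integral_smul, ← integral_add]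
      · refine integral_congr_ae (Eventually.of_forall fun Y => ?_)
        simp only [smul_add, smul_smul, Real.norm_eq_abs, sq_abs]
        congr 2 <;> ring
      · exact e1.smul_const _
      · exact h7.smul _
    have h9 : ‖gradMulSqrtConv R S g T T' X‖ ≤
        √(∫ Y, g Y * ‖T (X - Y) • S X + R X • T' (X - Y)‖ ^ 2) := by
      have : gradMulSqrtConv R S g T T' X = (√(sqConv g T X).toReal)⁻¹ •
          ∫ Y, (g Y * T (X - Y)) • (T (X - Y) • S X + R X • T' (X - Y)) := by
        rw [h8, gradMulSqrtConv, smul_add, smul_smul, smul_smul, mul_comm (R X)]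
        congr 2
        -- The identity √H = (√H)⁻¹ H also holds at H = 0, where both sides are 0.
        rcases (Real.sqrt_nonneg (sqConv g T X).toReal).eq_or_lt with h | h
        · rw [← h]; simp
        · rw [eq_inv_mul_iff_mul_eq₀ h.ne', Real.mul_self_sqrt ENNReal.toReal_nonneg]
      rw [this]
      refine norm_inv_smul_le le_rfl (h6.trans_eq ?_)
      rw [e2]
      simp
    calc _ ≤ _ := pow_le_pow_left₀ (norm_nonneg _) h9 2
      _ = _ := Real.sq_sqrt (integral_nonneg fun Y => mul_nonneg (hg0 Y) (by positivity))

/-- If `∫ ‖a‖² H` is finite, then `‖a‖ √H` is square integrable and `H` is finite where `a ≠ 0`. -/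
theorem memLp_norm_mul_sqrt {E : Type*} [NormedAddCommGroup E] {a : V → E} {H : V → ℝ≥0∞}
    (ha : AEStronglyMeasurable a volume) (hH : AEMeasurable H volume)
    (h : ∫⁻ X, ‖a X‖ₑ ^ 2 * H X ≠ ⊤) :
    (∀ᵐ X, a X ≠ 0 → H X ≠ ⊤) ∧ MemLp (fun X => ‖a X‖ * √(H X).toReal) 2 volume := by
  have hm : AEMeasurable (fun X => ‖a X‖ₑ ^ 2 * H X) volume := (ha.enorm.pow_const 2).mul hH
  constructor
  · filter_upwards [ae_lt_top' hm h] with X hX h0 htop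
    rw [htop, ENNReal.mul_top (by simpa using h0)] at hX
    exact lt_irrefl _ hX
  · have hm' : AEStronglyMeasurable (fun X => ‖a X‖ * √(H X).toReal) volume :=
      ha.norm.mul (Real.continuous_sqrt.comp_aestronglyMeasurable
        hH.ennreal_toReal.aestronglyMeasurable)
    rw [memLp_two_iff_integrable_sq hm']
    refine (integrable_toReal_of_lintegral_ne_top hm h).congr (Eventually.of_forall fun X => ?_)
    simp only [ENNReal.toReal_mul, ENNReal.toReal_pow, toReal_enorm, mul_pow,
      Real.sq_sqrt ENNReal.toReal_nonneg]

end

/-! ### Tensor products and their weak gradients -/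

namespace Config

variable {N d : ℕ}

/-- The product function `X ↦ ∏ f(x_i)`. -/
noncomputable def tensor (f : Space d → ℝ) (X : Config N d) : ℝ := ∏ i, f (X i)

/-- The gradient of `X ↦ ∏ f(x_i)`, where `G` is the gradient of `f`. -/
noncomputable def tensorGrad (f : Space d → ℝ) (G : Space d → Space d) (X : Config N d) :
    Config N d :=
  WithLp.toLp 2 fun i => (∏ j ∈ Finset.univ.erase i, f (X j)) • G (X i)

/-- Absorbing the exceptional factor yields a full product over the particles, the form to which
Fubini for products applies. -/
theorem prod_erase_mul {M : Type*} [CommMonoid M] (a : Fin N → M) (b : Fin N → M) (i : Fin N) :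
    (∏ j ∈ Finset.univ.erase i, a j) * b i = ∏ j, if j = i then b j else a j := by
  rw [← Finset.prod_erase_mul _ _ (Finset.mem_univ i), if_pos rfl]
  congr 1
  exact Finset.prod_congr rfl fun j hj => (if_neg (Finset.ne_of_mem_erase hj)).symm

theorem hasGradientAt_tensor {f : Space d → ℝ} {f' : Space d → Space d}
    (hf : ∀ x, HasGradientAt f (f' x) x) (X : Config N d) :
    HasGradientAt (tensor f) (tensorGrad f f' X) X := by
  rw [hasGradientAt_iff_hasFDerivAt]
  have h1 : ∀ i ∈ (Finset.univ : Finset (Fin N)), HasFDerivAt (fun X : Config N d => f (X i))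
      ((InnerProductSpace.toDual ℝ _ (f' (X i))).comp
        (PiLp.proj 2 (fun _ : Fin N => Space d) i : Config N d →L[ℝ] Space d)) X := fun i _ =>
    (hf (X i)).hasFDerivAt.comp X
      (PiLp.proj 2 (fun _ : Fin N => Space d) i : Config N d →L[ℝ] Space d).hasFDerivAt
  refine (HasFDerivAt.finsetProd h1).congr_fderiv ?_
  refine ContinuousLinearMap.ext fun v => ?_
  rw [InnerProductSpace.toDual_apply_apply, PiLp.inner_apply]
  simp only [sum_apply, smul_apply, ContinuousLinearMap.comp_apply,
    InnerProductSpace.toDual_apply_apply, tensorGrad, real_inner_smul_left, smul_eq_mul]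
  rfl

theorem contDiff_tensor {f : Space d → ℝ} (hf : ContDiff ℝ ∞ f) :
    ContDiff ℝ ∞ (tensor f : Config N d → ℝ) :=
  contDiff_prod fun i _ => hf.comp
    (PiLp.proj 2 (fun _ : Fin N => Space d) i : Config N d →L[ℝ] Space d).contDiff

theorem hasCompactSupport_tensor {f : Space d → ℝ} (hf : HasCompactSupport f) :
    HasCompactSupport (tensor f : Config N d → ℝ) := by
  have hK : IsCompact (MeasurableEquiv.toLp 2 (Fin N → Space d) ''
      (Set.univ.pi fun _ => tsupport f)) :=
    (isCompact_univ_pi fun _ => hf).image (PiLp.continuous_toLp 2 _)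
  refine HasCompactSupport.intro hK fun X hX => ?_
  by_contra h
  refine hX ⟨fun i => X i, fun i _ => subset_tsupport f fun h0 => h ?_, rfl⟩
  exact Finset.prod_eq_zero (Finset.mem_univ i) h0

theorem norm_tensorGrad_sq (f : Space d → ℝ) (G : Space d → Space d) (X : Config N d) :
    ‖tensorGrad f G X‖ ^ 2 = ∑ i, ∏ j, if j = i then ‖G (X j)‖ ^ 2 else f (X j) ^ 2 := by
  rw [PiLp.norm_sq_eq_of_L2]
  refine Finset.sum_congr rfl fun i _ => ?_
  rw [← prod_erase_mul (fun j => f (X j) ^ 2) (fun j => ‖G (X j)‖ ^ 2) i]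
  simp [tensorGrad, norm_smul, mul_pow, Finset.prod_pow, sq_abs, ← Finset.abs_prod]

theorem aestronglyMeasurable_comp_apply {E : Type*} [TopologicalSpace E] {f : Space d → E}
    (hf : AEStronglyMeasurable f volume) (i : Fin N) :
    AEStronglyMeasurable (fun X : Config N d => f (X i)) volume :=
  hf.comp_quasiMeasurePreserving (quasiMeasurePreserving_apply i)

theorem integrable_prod {f : Fin N → Space d → ℝ} (hf : ∀ i, Integrable (f i)) :
    Integrable fun X : Config N d => ∏ i, f i (X i) :=
  (volume_preserving_toLp.integrable_comp_emb (MeasurableEquiv.measurableEmbedding _)).1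
    (Integrable.fintype_prod hf)

theorem memLp_tensor {f : Space d → ℝ} (hf : MemLp f 2 volume) :
    MemLp (tensor f : Config N d → ℝ) 2 volume := by
  have hm : AEStronglyMeasurable (tensor f : Config N d → ℝ) volume :=
    Finset.aestronglyMeasurable_fun_prod _ fun i _ =>
      aestronglyMeasurable_comp_apply hf.aestronglyMeasurable i
  rw [memLp_two_iff_integrable_sq hm]
  have := integrable_prod (N := N) fun _ => hf.integrable_sq
  simpa [tensor, Finset.prod_pow] using this

theorem memLp_tensorGrad {f : Space d → ℝ} {G : Space d → Space d} (hf : MemLp f 2 volume)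
    (hG : MemLp G 2 volume) : MemLp (tensorGrad f G : Config N d → Config N d) 2 volume := by
  have hm : AEStronglyMeasurable (tensorGrad f G : Config N d → Config N d) volume := by
    have h1 : AEMeasurable (fun (X : Config N d) i =>
        (∏ j ∈ Finset.univ.erase i, f (X j)) • G (X i)) volume :=
      aemeasurable_pi_iff.2 fun i => ((Finset.aestronglyMeasurable_fun_prod _ fun j _ =>
        aestronglyMeasurable_comp_apply hf.aestronglyMeasurable j).smul
          (aestronglyMeasurable_comp_apply hG.aestronglyMeasurable i)).aemeasurable
    exact ((PiLp.continuous_toLp 2 _).measurable.comp_aemeasurable h1).aestronglyMeasurable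
  rw [memLp_two_iff_integrable_sq_norm hm]
  simp only [norm_tensorGrad_sq]
  refine integrable_finsetSum _ fun i _ => ?_
  refine (integrable_prod (N := N) (f := fun j x => if j = i then ‖G x‖ ^ 2 else f x ^ 2) fun j => ?_)
  by_cases h : j = i
  · simpa [h] using hG.norm.integrable_sq
  · simpa [h] using hf.integrable_sq

/-- The configuration with `x` at position `i` and the particles `Z` elsewhere. -/
noncomputable def insertAt {n : ℕ} (i : Fin (n + 1)) (x : Space d) (Z : Fin n → Space d) :
    Config (n + 1) d :=
  WithLp.toLp 2 (i.insertNth x Z)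

theorem insertAt_same {n : ℕ} (i : Fin (n + 1)) (x : Space d) (Z : Fin n → Space d) :
    insertAt i x Z i = x :=
  Fin.insertNth_apply_same (α := fun _ => Space d) i x Z

theorem insertAt_succAbove {n : ℕ} (i : Fin (n + 1)) (x : Space d) (Z : Fin n → Space d)
    (k : Fin n) : insertAt i x Z (i.succAbove k) = Z k :=
  Fin.insertNth_apply_succAbove (α := fun _ => Space d) i x Z k

theorem measurePreserving_insertAt {n : ℕ} (i : Fin (n + 1)) :
    MeasurePreserving (fun p : Space d × (Fin n → Space d) => insertAt i p.1 p.2)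
      (volume.prod volume) volume ∧
    MeasurableEmbedding (fun p : Space d × (Fin n → Space d) => insertAt i p.1 p.2) := by
  let e := (MeasurableEquiv.piFinSuccAbove (fun _ : Fin (n + 1) => Space d) i).symm.trans
    (MeasurableEquiv.toLp 2 (Fin (n + 1) → Space d))
  have h : MeasurePreserving e volume volume :=
    (volume_preserving_piFinSuccAbove (fun _ : Fin (n + 1) => Space d) i).symm.trans
      volume_preserving_toLp
  exact ⟨h, e.measurableEmbedding⟩

/-- Integration over a configuration, over the `i`-th particle first. -/
theorem integral_eq_integral_insertAt {n : ℕ} (i : Fin (n + 1)) {F : Config (n + 1) d → ℝ}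
    (hF : Integrable F) : ∫ X, F X = ∫ Z : Fin n → Space d, ∫ x, F (insertAt i x Z) := by
  obtain ⟨h, he⟩ := measurePreserving_insertAt (d := d) i
  rw [← h.integral_comp he]
  exact integral_prod_symm _ ((h.integrable_comp_emb he).2 hF)

/-- The inclusion of the `i`-th factor. -/
noncomputable def inclusion (i : Fin N) : Space d →L[ℝ] Config N d :=
  ((PiLp.continuousLinearEquiv 2 ℝ (fun _ : Fin N => Space d)).symm :
    (Fin N → Space d) →L[ℝ] Config N d).comp (ContinuousLinearMap.single ℝ (fun _ => Space d) i)

theorem inclusion_apply (i j : Fin N) (x : Space d) :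
    (inclusion i x : Config N d) j = if j = i then x else 0 := by
  simp [inclusion]

theorem inner_inclusion (v : Config N d) (i : Fin N) (u : Space d) :
    inner ℝ v (inclusion i u) = inner ℝ (v i) u := by
  rw [PiLp.inner_apply, Finset.sum_eq_single i]
  · rw [inclusion_apply, if_pos rfl]
  · intro j _ hj
    rw [inclusion_apply, if_neg hj, inner_zero_right]
  · simp

theorem sum_inclusion (v : Config N d) : v = ∑ i, inclusion i (v i) := by
  ext j : 1
  simp [inclusion_apply]

theorem insertAt_eq {n : ℕ} (i : Fin (n + 1)) (x : Space d) (Z : Fin n → Space d) :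
    insertAt i x Z = inclusion i x + insertAt i 0 Z := by
  ext j : 1
  rw [PiLp.add_apply, inclusion_apply]
  refine Fin.succAboveCases i ?_ (fun k => ?_) j
  · simp [insertAt_same]
  · simp [insertAt_succAbove, Fin.succAbove_ne]

/-- The weak gradient of a product function, tested in the direction of the `i`-th particle. -/
theorem integral_tensor_mul_fderiv_inclusion {f : Space d → ℝ} {G : Space d → Space d}
    (h : HasWeakGradient f G) (hf : MemLp f 2 volume) (hG : MemLp G 2 volume)
    {ψ : Config N d → ℝ} (hψ : ContDiff ℝ ∞ ψ) (hc : HasCompactSupport ψ) (i : Fin N)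
    (u : Space d) :
    ∫ X, tensor f X * fderiv ℝ ψ X (inclusion i u) =
      - ∫ X, inner ℝ (tensorGrad f G X i) u * ψ X := by
  have hcd : HasCompactSupport fun x => fderiv ℝ ψ x (inclusion i u) :=
    hc.fderiv_apply (𝕜 := ℝ) _
  have hψc : Continuous fun x => fderiv ℝ ψ x (inclusion i u) :=
    (hψ.continuous_fderiv (by simp)).clm_apply continuous_const
  have j1 : Integrable fun X => tensor f X * fderiv ℝ ψ X (inclusion i u) :=
    ((memLp_tensor hf).locallyIntegrable (by norm_num)).integrable_mul_of_hasCompactSupport hψc hcd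
  have j2 : Integrable fun X => inner ℝ (tensorGrad f G X i) u * ψ X := by
    have := (((memLp_tensorGrad (N := N) hf hG).locallyIntegrable (by norm_num)).inner_const'
      (inclusion i u)).integrable_mul_of_hasCompactSupport hψ.continuous hc
    refine this.congr (Eventually.of_forall fun X => ?_)
    simp only [inner_inclusion]
  -- Isolating the i-th particle needs N = n + 1; for N = 0 there is no i.
  rcases N with _ | n
  · exact i.elim0
  rw [integral_eq_integral_insertAt i j1, integral_eq_integral_insertAt i j2, ← integral_neg]
  congr 1
  ext Z
  set ψZ := fun x => ψ (insertAt i x Z) with hψZ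
  have hins : (fun x => insertAt i x Z) = fun x => inclusion i x + insertAt i 0 Z :=
    funext fun x => insertAt_eq i x Z
  have hd : ∀ x, HasFDerivAt (fun x => insertAt i x Z) (inclusion i : Space d →L[ℝ] _) x := fun x => by
    rw [hins]
    exact (inclusion i).hasFDerivAt.add_const _
  have hψZs : ContDiff ℝ ∞ ψZ := by
    refine hψ.comp (g := ψ) (f := fun x => insertAt i x Z) ?_
    rw [hins]
    exact (inclusion i).contDiff.add contDiff_const
  -- The slice vanishes outside the projection of the support of ψ to the i-th factor.
  have hψZc : HasCompactSupport ψZ := by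
    refine HasCompactSupport.intro (hc.image (PiLp.continuous_apply 2 (fun _ => Space d) i))
      fun x hx => ?_
    by_contra h0
    exact hx ⟨insertAt i x Z, subset_tsupport _ h0, insertAt_same i x Z⟩
  have key := h.integral_eq ψZ hψZs hψZc u
  have e1 : ∀ x, tensor f (insertAt i x Z) * fderiv ℝ ψ (insertAt i x Z) (inclusion i u)
      = (∏ j, f (Z j)) * (f x * fderiv ℝ ψZ x u) := fun x => by
    have : fderiv ℝ ψZ x = (fderiv ℝ ψ (insertAt i x Z)).comp (inclusion i) :=
      ((hψ.differentiable (by simp) _).hasFDerivAt.comp x (hd x)).fderiv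
    rw [this, tensor, Fin.prod_univ_succAbove _ i]
    simp only [insertAt_same, insertAt_succAbove, ContinuousLinearMap.comp_apply]
    ring
  have e2 : ∀ x, inner ℝ (tensorGrad f G (insertAt i x Z) i) u * ψ (insertAt i x Z)
      = (∏ j, f (Z j)) * (inner ℝ (G x) u * ψZ x) := fun x => by
    have : ∏ j ∈ Finset.univ.erase i, f (insertAt i x Z j) = ∏ j, f (Z j) := by
      have h1 : (Finset.univ.erase i) = Finset.univ.map (Fin.succAboveEmb i) := by
        ext j
        simp only [Finset.mem_erase, Finset.mem_univ, and_true, Finset.mem_map, true_and]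
        exact Fin.exists_succAbove_eq_iff.symm
      rw [h1, Finset.prod_map]
      simp [insertAt_succAbove]
    simp only [tensorGrad, this, real_inner_smul_left, ψZ]
    rw [insertAt_same]
    ring
  simp only [e1, e2]
  rw [integral_const_mul, integral_const_mul, key, mul_neg]

theorem hasWeakGradient_tensor {f : Space d → ℝ} {G : Space d → Space d}
    (h : HasWeakGradient f G) (hf : MemLp f 2 volume) (hG : MemLp G 2 volume) :
    HasWeakGradient (tensor f : Config N d → ℝ) (tensorGrad f G) := by
  have l1 := (memLp_tensor (N := N) hf).locallyIntegrable (by norm_num)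
  have l2 := (memLp_tensorGrad (N := N) hf hG).locallyIntegrable (by norm_num)
  refine ⟨l1, l2, fun ψ hψ hc v => ?_⟩
  -- By linearity in v it is enough to test directions that move a single particle.
  have e1 : ∀ X, tensor f X * fderiv ℝ ψ X v
      = ∑ i, tensor f X * fderiv ℝ ψ X (inclusion i (v i)) := fun X => by
    conv_lhs => rw [sum_inclusion v, map_sum, Finset.mul_sum]
  have e2 : ∀ X, inner ℝ (tensorGrad f G X) v * ψ X
      = ∑ i, inner ℝ (tensorGrad f G X i) (v i) * ψ X := fun X => by
    rw [PiLp.inner_apply, Finset.sum_mul]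
  simp only [e1, e2]
  rw [integral_finsetSum, integral_finsetSum, ← Finset.sum_neg_distrib]
  · exact Finset.sum_congr rfl fun i _ =>
      integral_tensor_mul_fderiv_inclusion h hf hG hψ hc i (v i)
  · intro i _
    have := (l2.inner_const' (inclusion i (v i))).integrable_mul_of_hasCompactSupport
      hψ.continuous hc
    refine this.congr (Eventually.of_forall fun X => ?_)
    simp only [inner_inclusion]
  · intro i _
    exact l1.integrable_mul_of_hasCompactSupport
      ((hψ.continuous_fderiv (by simp)).clm_apply continuous_const) (hc.fderiv_apply (𝕜 := ℝ) _)

end Config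

/-! ### The standard mollifier, its square root and its energy -/

section Mollifier

variable {d : ℕ}

/-- Halving the exponent -1/x amounts to doubling x. This is why √η is smooth up to and across the
edge of its support. -/
theorem sqrt_expNegInvGlue (x : ℝ) : √(expNegInvGlue x) = expNegInvGlue (2 * x) := by
  unfold expNegInvGlue
  by_cases h : x ≤ 0
  · simp [h]
  · rw [if_neg h, if_neg (by linarith), Real.sqrt_eq_iff_mul_self_eq (Real.exp_nonneg _)
      (Real.exp_nonneg _), ← Real.exp_add]
    congr 1
    have : x ≠ 0 := fun h0 => h h0.le
    field_simp
    norm_num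

theorem contDiff_bump (c : ℝ) :
    ContDiff ℝ ∞ fun v : Space d => expNegInvGlue (c * (1 - ‖v‖ ^ 2)) :=
  expNegInvGlue.contDiff.comp (contDiff_const.mul (contDiff_const.sub (contDiff_norm_sq ℝ)))

theorem hasCompactSupport_bump {c : ℝ} (hc : 0 ≤ c) :
    HasCompactSupport fun v : Space d => expNegInvGlue (c * (1 - ‖v‖ ^ 2)) := by
  refine HasCompactSupport.intro (isCompact_closedBall 0 1) fun v hv => ?_
  have : 1 < ‖v‖ := by simpa using hv
  exact expNegInvGlue.zero_of_nonpos (mul_nonpos_of_nonneg_of_nonpos hc (by nlinarith))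

theorem integral_bump_pos : 0 < ∫ v : Space d, expNegInvGlue (1 - ‖v‖ ^ 2) := by
  have h1 : Continuous fun v : Space d => expNegInvGlue (1 - ‖v‖ ^ 2) := by
    simpa using (contDiff_bump (d := d) 1).continuous
  have h2 : HasCompactSupport fun v : Space d => expNegInvGlue (1 - ‖v‖ ^ 2) := by
    simpa using hasCompactSupport_bump (d := d) zero_le_one
  refine h1.integral_pos_of_hasCompactSupport_nonneg_nonzero h2
    (fun v => expNegInvGlue.nonneg _) (x := 0) ?_
  simp

theorem stdMollifier_nonneg (u : Space d) : 0 ≤ stdMollifier d u :=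
  mul_nonneg (inv_nonneg.2 integral_bump_pos.le) (expNegInvGlue.nonneg _)

theorem integral_stdMollifier : ∫ u, stdMollifier d u = 1 := by
  unfold stdMollifier
  rw [integral_const_mul, inv_mul_cancel₀ integral_bump_pos.ne']

variable {ε : ℝ}

theorem scaledMollifier_nonneg (hε : 0 < ε) (u : Space d) : 0 ≤ scaledMollifier d ε u :=
  mul_nonneg (by positivity) (stdMollifier_nonneg _)

theorem integral_scaledMollifier (hε : 0 < ε) : ∫ u, scaledMollifier d ε u = 1 := by
  unfold scaledMollifier
  rw [integral_const_mul, Measure.integral_comp_inv_smul_of_nonneg _ _ hε.le,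
    integral_stdMollifier]
  simp [hε.ne']

theorem scaledMollifier_eq_zero (hε : 0 < ε) {u : Space d} (hu : ε ≤ ‖u‖) :
    scaledMollifier d ε u = 0 := by
  have : 1 ≤ ‖ε⁻¹ • u‖ := by
    rw [norm_smul, norm_inv, Real.norm_of_nonneg hε.le, ← div_eq_inv_mul]
    exact (one_le_div hε).2 hu
  rw [scaledMollifier, stdMollifier, expNegInvGlue.zero_of_nonpos (by nlinarith)]
  simp

theorem scaledMollifier_neg (u : Space d) : scaledMollifier d ε (-u) = scaledMollifier d ε u := by
  simp [scaledMollifier, stdMollifier]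

/-- The square root of the mollifier. -/
noncomputable def sqrtMollifier (d : ℕ) (ε : ℝ) (u : Space d) : ℝ := √(scaledMollifier d ε u)

theorem sqrtMollifier_eq (hε : 0 < ε) : sqrtMollifier d ε = fun u =>
    √((ε ^ d)⁻¹ * (∫ v : Space d, expNegInvGlue (1 - ‖v‖ ^ 2))⁻¹) *
      expNegInvGlue (2 * (1 - ‖ε⁻¹ • u‖ ^ 2)) := by
  ext u
  rw [sqrtMollifier, scaledMollifier, stdMollifier, ← mul_assoc, Real.sqrt_mul, sqrt_expNegInvGlue]
  have := integral_bump_pos (d := d)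
  positivity

theorem contDiff_sqrtMollifier (hε : 0 < ε) : ContDiff ℝ ∞ (sqrtMollifier d ε) := by
  rw [sqrtMollifier_eq hε]
  exact contDiff_const.mul ((contDiff_bump 2).comp (contDiff_const_smul _))

theorem hasCompactSupport_sqrtMollifier (hε : 0 < ε) : HasCompactSupport (sqrtMollifier d ε) := by
  refine HasCompactSupport.intro (isCompact_closedBall 0 ε) fun v hv => ?_
  have : ε < ‖v‖ := by simpa using hv
  rw [sqrtMollifier, scaledMollifier_eq_zero hε this.le, Real.sqrt_zero]

theorem sqrtMollifier_sq (hε : 0 < ε) (u : Space d) :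
    sqrtMollifier d ε u ^ 2 = scaledMollifier d ε u :=
  Real.sq_sqrt (scaledMollifier_nonneg hε u)

theorem continuous_scaledMollifier (hε : 0 < ε) : Continuous (scaledMollifier d ε) := by
  have : scaledMollifier d ε = fun u => sqrtMollifier d ε u ^ 2 := by
    ext u; rw [sqrtMollifier_sq hε]
  rw [this]
  exact (contDiff_sqrtMollifier hε).continuous.pow 2

theorem integrable_scaledMollifier (hε : 0 < ε) : Integrable (scaledMollifier d ε) := by
  -- A nonintegrable function would have integral 0 by convention, not 1.
  by_contra h
  have := integral_scaledMollifier (d := d) hε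
  rw [integral_undef h] at this
  exact zero_ne_one this

theorem hasGradientAt_sqrtMollifier (hε : 0 < ε) (u : Space d) :
    HasGradientAt (sqrtMollifier d ε) (gradient (sqrtMollifier d ε) u) u :=
  ((contDiff_sqrtMollifier hε).differentiable (by simp) u).hasGradientAt

theorem continuous_gradient_sqrtMollifier (hε : 0 < ε) :
    Continuous (gradient (sqrtMollifier d ε)) :=
  continuous_gradient (contDiff_sqrtMollifier hε) (hasGradientAt_sqrtMollifier hε)

theorem gradient_sqrtMollifier_neg (hε : 0 < ε) (u : Space d) :
    gradient (sqrtMollifier d ε) (-u) = - gradient (sqrtMollifier d ε) u := by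
  have h1 := (hasGradientAt_sqrtMollifier (d := d) hε (-u)).hasFDerivAt.comp u
    (hasFDerivAt_id u).neg
  have h2 : (sqrtMollifier d ε ∘ fun x : Space d => -x) = sqrtMollifier d ε := by
    ext x; simp [sqrtMollifier, scaledMollifier_neg]
  have h3 := (hasGradientAt_sqrtMollifier (d := d) hε u).hasFDerivAt
  have h4 : HasFDerivAt (sqrtMollifier d ε ∘ fun x : Space d => -x)
      (InnerProductSpace.toDual ℝ _ (-gradient (sqrtMollifier d ε) (-u))) u :=
    h1.congr_fderiv (ContinuousLinearMap.ext fun v => by simp)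
  rw [h2] at h4
  have := (InnerProductSpace.toDual ℝ (Space d)).injective (h4.unique h3)
  rw [← this, neg_neg]

theorem gradient_sqrtMollifier_scale (hε : 0 < ε) (u : Space d) :
    gradient (sqrtMollifier d ε) u =
      (√((ε ^ d)⁻¹) * ε⁻¹) • gradient (sqrtMollifier d 1) (ε⁻¹ • u) := by
  have h2 : sqrtMollifier d ε = fun x => √((ε ^ d)⁻¹) * sqrtMollifier d 1 (ε⁻¹ • x) := by
    ext x
    rw [sqrtMollifier, sqrtMollifier, scaledMollifier, scaledMollifier,
      Real.sqrt_mul (by positivity)]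
    simp
  have h1 := ((hasGradientAt_sqrtMollifier (d := d) one_pos (ε⁻¹ • u)).hasFDerivAt.comp u
    ((hasFDerivAt_id u).const_smul ε⁻¹)).const_mul √((ε ^ d)⁻¹)
  refine HasGradientAt.gradient (hasGradientAt_iff_hasFDerivAt.2 ?_)
  rw [h2]
  refine h1.congr_fderiv (ContinuousLinearMap.ext fun v => ?_)
  simp
  ring

/-- The constant `∫ |∇√η|²` of the standard mollifier. -/
noncomputable def mollifierEnergy (d : ℕ) : ℝ := ∫ u, ‖gradient (sqrtMollifier d 1) u‖ ^ 2

theorem mollifierEnergy_nonneg : 0 ≤ mollifierEnergy d := integral_nonneg fun _ => by positivity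

theorem integral_norm_gradient_sqrtMollifier_sq (hε : 0 < ε) :
    ∫ u, ‖gradient (sqrtMollifier d ε) u‖ ^ 2 = mollifierEnergy d / ε ^ 2 := by
  have h : ∀ u, ‖gradient (sqrtMollifier d ε) u‖ ^ 2 =
      ((ε ^ d)⁻¹ * (ε⁻¹) ^ 2) * ‖gradient (sqrtMollifier d 1) (ε⁻¹ • u)‖ ^ 2 := fun u => by
    rw [gradient_sqrtMollifier_scale hε, norm_smul, mul_pow, Real.norm_eq_abs, sq_abs, mul_pow,
      Real.sq_sqrt (by positivity)]
  simp only [h]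
  rw [integral_const_mul, Measure.integral_comp_inv_smul_of_nonneg volume
    (fun u => ‖gradient (sqrtMollifier d 1) u‖ ^ 2) hε.le, mollifierEnergy]
  simp only [finrank_euclideanSpace, Fintype.card_fin, smul_eq_mul]
  field_simp

theorem integrable_norm_gradient_sqrtMollifier_sq (hε : 0 < ε) :
    Integrable fun u : Space d => ‖gradient (sqrtMollifier d ε) u‖ ^ 2 := by
  have h1 : HasCompactSupport (gradient (sqrtMollifier d ε)) :=
    hasCompactSupport_gradient (hasCompactSupport_sqrtMollifier hε) (hasGradientAt_sqrtMollifier hε)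
  have h2 : HasCompactSupport fun u : Space d => ‖gradient (sqrtMollifier d ε) u‖ ^ 2 :=
    h1.comp_left (g := fun e : Space d => ‖e‖ ^ 2) (by simp)
  have h3 : Continuous fun u : Space d => ‖gradient (sqrtMollifier d ε) u‖ ^ 2 :=
    (continuous_gradient_sqrtMollifier hε).norm.pow 2
  exact h3.integrable_of_hasCompactSupport h2

/-- The integrand is odd, being an even function times its odd gradient. This kills the cross term
of the localization energy. -/
theorem integral_sqrtMollifier_smul_gradient (hε : 0 < ε) :
    ∫ u, sqrtMollifier d ε u • gradient (sqrtMollifier d ε) u = 0 := by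
  have h := integral_neg_eq_self
    (fun u => sqrtMollifier d ε u • gradient (sqrtMollifier d ε) u) volume
  have h2 : ∀ u, sqrtMollifier d ε (-u) = sqrtMollifier d ε u := fun u => by
    simp [sqrtMollifier, scaledMollifier_neg]
  simp only [h2, gradient_sqrtMollifier_neg hε, smul_neg, integral_neg] at h
  set I := ∫ u, sqrtMollifier d ε u • gradient (sqrtMollifier d ε) u
  have h3 : (2 : ℝ) • I = 0 := by
    rw [two_smul]
    nth_rewrite 1 [← h]
    exact neg_add_cancel I
  exact (smul_eq_zero.1 h3).resolve_left two_ne_zero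

/-- The localization energy of a one-particle function at one point. -/
theorem lintegral_norm_localization_sq (hε : 0 < ε) (p : Space d) (c : ℝ) (x : Space d) :
    ∫⁻ y, ENNReal.ofReal (‖sqrtMollifier d ε (x - y) • p +
        c • gradient (sqrtMollifier d ε) (x - y)‖ ^ 2) =
      ENNReal.ofReal (‖p‖ ^ 2 + c ^ 2 * (mollifierEnergy d / ε ^ 2)) := by
  rw [lintegral_sub_left_eq_self (fun u => ENNReal.ofReal (‖sqrtMollifier d ε u • p +
        c • gradient (sqrtMollifier d ε) u‖ ^ 2)) x]
  have hi : Integrable fun u : Space d => sqrtMollifier d ε u • gradient (sqrtMollifier d ε) u :=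
    ((contDiff_sqrtMollifier hε).continuous.smul
      (continuous_gradient_sqrtMollifier hε)).integrable_of_hasCompactSupport
      (hasCompactSupport_sqrtMollifier hε).smul_right
  -- After the substitution u = x - y the three terms integrate to ‖p‖² (unit mass), 0 (oddness) and
  -- the rescaled mollifier energy.
  have hexp : ∀ u, ‖sqrtMollifier d ε u • p + c • gradient (sqrtMollifier d ε) u‖ ^ 2 =
      ‖p‖ ^ 2 * scaledMollifier d ε u +
      (2 * c) * inner ℝ p (sqrtMollifier d ε u • gradient (sqrtMollifier d ε) u) +
      c ^ 2 * ‖gradient (sqrtMollifier d ε) u‖ ^ 2 := fun u => by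
    rw [norm_add_sq_real, norm_smul, norm_smul, mul_pow, mul_pow, Real.norm_eq_abs, Real.norm_eq_abs,
      sq_abs, sq_abs, sqrtMollifier_sq hε, real_inner_smul_left, real_inner_smul_right,
      real_inner_smul_right]
    ring
  have j1 := (integrable_scaledMollifier (d := d) hε).const_mul (‖p‖ ^ 2)
  have j2 := (hi.const_inner (𝕜 := ℝ) p).const_mul (2 * c)
  have j3 := (integrable_norm_gradient_sqrtMollifier_sq (d := d) hε).const_mul (c ^ 2)
  rw [← ofReal_integral_eq_lintegral_ofReal]
  · congr 1
    simp only [hexp]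
    have e := integral_add (f := fun u => ‖p‖ ^ 2 * scaledMollifier d ε u +
      (2 * c) * inner ℝ p (sqrtMollifier d ε u • gradient (sqrtMollifier d ε) u)) (j1.add j2) j3
    rw [e, integral_add j1 j2, integral_const_mul, integral_const_mul,
      integral_const_mul, integral_inner hi, integral_sqrtMollifier_smul_gradient hε,
      integral_scaledMollifier hε, integral_norm_gradient_sqrtMollifier_sq hε]
    simp
  · simp only [hexp]
    exact (j1.add j2).add j3
  · exact Eventually.of_forall fun u => by positivity

theorem lintegral_scaledMollifier_sub_left (hε : 0 < ε) (x : Space d) :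
    ∫⁻ y, ENNReal.ofReal (scaledMollifier d ε (y - x)) = 1 := by
  rw [lintegral_sub_right_eq_self (fun u => ENNReal.ofReal (scaledMollifier d ε u)) x,
    ← ofReal_integral_eq_lintegral_ofReal (integrable_scaledMollifier hε)
      (Eventually.of_forall (scaledMollifier_nonneg hε)), integral_scaledMollifier hε]
  simp

end Mollifier

/-! ### Mollified and recomposed plans: mass, marginals, displacement -/

theorem lintegral_lintegral_mul_swap {α β : Type*} [MeasurableSpace α] [MeasurableSpace β]
    {μ : Measure α} {ν : Measure β} [SFinite μ] [SFinite ν] {A : α → β → ℝ≥0∞} {F : α → ℝ≥0∞}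
    (hA : Measurable fun p : α × β => A p.1 p.2) (hF : Measurable F) :
    ∫⁻ x, (∫⁻ y, A x y ∂ν) * F x ∂μ = ∫⁻ y, ∫⁻ x, A x y * F x ∂μ ∂ν := by
  rw [← lintegral_lintegral_swap (hA.mul (hF.comp measurable_fst)).aemeasurable]
  refine lintegral_congr fun x => (lintegral_mul_const _ ?_).symm
  exact hA.comp (measurable_prodMk_left (x := x))

section Recomposition

variable {N d : ℕ} {ε : ℝ}

/-- The mollifier as a kernel with values in `ℝ≥0∞`. -/
noncomputable def mollifierKernel (d : ℕ) (ε : ℝ) (u : Space d) : ℝ≥0∞ :=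
  ENNReal.ofReal (scaledMollifier d ε u)

theorem measurable_prod_apply {F : Space d → Space d → ℝ≥0∞}
    (hF : Measurable fun q : Space d × Space d => F q.1 q.2) :
    Measurable fun p : Config N d × Config N d => ∏ i, F (p.1 i) (p.2 i) := by
  refine Finset.measurable_prod _ fun i _ => ?_
  have h : Measurable fun p : Config N d × Config N d => (p.1 i, p.2 i) :=
    ((Config.measurable_apply i).comp measurable_fst).prodMk
      ((Config.measurable_apply i).comp measurable_snd)
  exact hF.comp h

theorem measurable_mollifierKernel (hε : 0 < ε) : Measurable (mollifierKernel d ε) :=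
  (continuous_scaledMollifier hε).measurable.ennreal_ofReal

theorem measurable_mollifierKernel_sub (hε : 0 < ε) :
    Measurable fun q : Space d × Space d => mollifierKernel d ε (q.1 - q.2) :=
  (measurable_mollifierKernel hε).comp (measurable_fst.sub measurable_snd)

theorem mollifierKernel_neg (u : Space d) : mollifierKernel d ε (-u) = mollifierKernel d ε u := by
  rw [mollifierKernel, scaledMollifier_neg, mollifierKernel]

theorem mollifierKernel_sub_comm (x y : Space d) :
    mollifierKernel d ε (x - y) = mollifierKernel d ε (y - x) := by
  rw [← mollifierKernel_neg, neg_sub]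

theorem norm_lt_of_mollifierKernel_ne_zero (hε : 0 < ε) {u : Space d}
    (h : mollifierKernel d ε u ≠ 0) : ‖u‖ < ε := by
  by_contra hu
  exact h (by rw [mollifierKernel, scaledMollifier_eq_zero hε (not_lt.1 hu), ENNReal.ofReal_zero])

/-- A uniform bound on η_ε keeps ρ_ε and P̃_ε finite at every point, so that constants can be moved
out of integrals in `ℝ≥0∞`. -/
theorem exists_mollifierKernel_le (hε : 0 < ε) :
    ∃ C : ℝ≥0∞, C ≠ ⊤ ∧ ∀ u : Space d, mollifierKernel d ε u ≤ C := by
  obtain ⟨C, hC⟩ := (contDiff_sqrtMollifier (d := d) hε).continuous.bounded_above_of_compact_support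
    (hasCompactSupport_sqrtMollifier hε)
  refine ⟨ENNReal.ofReal (C ^ 2), ENNReal.ofReal_ne_top, fun u => ENNReal.ofReal_le_ofReal ?_⟩
  rw [← sqrtMollifier_sq hε, ← sq_abs]
  exact pow_le_pow_left₀ (abs_nonneg _) (hC u) 2

variable {ρ : Space d → ℝ}

theorem measurable_mollifiedDensity (hρ : Measurable ρ) (hε : 0 < ε) :
    Measurable (mollifiedDensity ρ ε) := by
  have : Measurable fun p : Space d × Space d =>
      ENNReal.ofReal (ρ p.2) * mollifierKernel d ε (p.1 - p.2) :=
    (hρ.comp measurable_snd).ennreal_ofReal.mul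
      ((measurable_mollifierKernel hε).comp (measurable_fst.sub measurable_snd))
  exact this.lintegral_prod_right'

theorem mollifiedDensity_ne_top (hρ1 : ∫⁻ x, ENNReal.ofReal (ρ x) = 1)
    (hε : 0 < ε) (y : Space d) : mollifiedDensity ρ ε y ≠ ⊤ := by
  obtain ⟨C, hC, h⟩ := exists_mollifierKernel_le (d := d) hε
  refine ne_top_of_le_ne_top hC ?_
  calc mollifiedDensity ρ ε y ≤ ∫⁻ x, ENNReal.ofReal (ρ x) * C :=
        lintegral_mono fun x => mul_le_mul_right (h (y - x)) _
    _ = C := by rw [lintegral_mul_const' _ _ hC, hρ1, one_mul]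

theorem measurable_mollifiedPlanDensity (P : ProbabilityMeasure (Config N d)) (hε : 0 < ε) :
    Measurable (mollifiedPlanDensity P ε) := by
  have : Measurable fun p : Config N d × Config N d =>
      ∏ i, mollifierKernel d ε (p.1 i - p.2 i) :=
    measurable_prod_apply (F := fun x y => mollifierKernel d ε (x - y))
      (measurable_mollifierKernel_sub hε)
  exact this.lintegral_prod_right'

theorem mollifiedPlanDensity_ne_top (P : ProbabilityMeasure (Config N d)) (hε : 0 < ε)
    (Y : Config N d) : mollifiedPlanDensity P ε Y ≠ ⊤ := by
  obtain ⟨C, hC, h⟩ := exists_mollifierKernel_le (d := d) hε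
  refine ne_top_of_le_ne_top (ENNReal.pow_ne_top hC (n := N)) ?_
  calc mollifiedPlanDensity P ε Y ≤ ∫⁻ X, C ^ N ∂(P : Measure (Config N d)) :=
        lintegral_mono fun X => (Finset.prod_le_pow_card _ _ _ fun i _ => h (Y i - X i)).trans
          (by simp)
    _ = C ^ N := by simp

/-- The reciprocal `1 / ρ_ε(y)`, read as `0` where `ρ_ε(y) = 0`. -/
noncomputable def invMollifiedDensity (ρ : Space d → ℝ) (ε : ℝ) (y : Space d) : ℝ≥0∞ :=
  open Classical in if mollifiedDensity ρ ε y = 0 then 0 else (mollifiedDensity ρ ε y)⁻¹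

theorem measurable_invMollifiedDensity (hρ : Measurable ρ) (hε : 0 < ε) :
    Measurable (invMollifiedDensity ρ ε) := by
  have h := measurable_mollifiedDensity hρ hε
  exact Measurable.ite (h (measurableSet_singleton 0)) measurable_const h.inv

theorem invMollifiedDensity_ne_top (y : Space d) : invMollifiedDensity ρ ε y ≠ ⊤ := by
  unfold invMollifiedDensity
  split_ifs with h
  · simp
  · simpa using h

theorem invMollifiedDensity_mul_of_ne_zero (hρ1 : ∫⁻ x, ENNReal.ofReal (ρ x) = 1) (hε : 0 < ε)
    {y : Space d} (h : mollifiedDensity ρ ε y ≠ 0) :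
    invMollifiedDensity ρ ε y * mollifiedDensity ρ ε y = 1 := by
  rw [invMollifiedDensity, if_neg h, ENNReal.inv_mul_cancel h (mollifiedDensity_ne_top hρ1 hε y)]

/-- The inequality survives at the zeros of ρ_ε, where the product is 0 instead of 1, so upper
bounds need no discussion of those points. -/
theorem invMollifiedDensity_mul_le (y : Space d) :
    invMollifiedDensity ρ ε y * mollifiedDensity ρ ε y ≤ 1 := by
  unfold invMollifiedDensity
  split_ifs with h
  · simp
  · exact ENNReal.inv_mul_le_one _

theorem prod_invMollifiedDensity_mul_le (Y : Config N d) :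
    ∏ i, invMollifiedDensity ρ ε (Y i) * mollifiedDensity ρ ε (Y i) ≤ 1 :=
  (Finset.prod_le_pow_card _ _ 1 fun i _ => invMollifiedDensity_mul_le (Y i)).trans (by simp)

theorem recompositionKernel_eq (x y : Space d) : recompositionKernel ρ ε x y =
    ENNReal.ofReal (ρ x) * mollifierKernel d ε (y - x) * invMollifiedDensity ρ ε y := by
  unfold recompositionKernel invMollifiedDensity
  split_ifs with h
  · simp
  · rfl

theorem measurable_recompositionKernel (hρ : Measurable ρ) (hε : 0 < ε) :
    Measurable fun p : Space d × Space d => recompositionKernel ρ ε p.1 p.2 := by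
  simp only [recompositionKernel_eq]
  exact ((hρ.comp measurable_fst).ennreal_ofReal.mul
    ((measurable_mollifierKernel hε).comp (measurable_snd.sub measurable_fst))).mul
    ((measurable_invMollifiedDensity hρ hε).comp measurable_snd)

theorem measurable_recompositionKernel_left (hρ : Measurable ρ) (hε : 0 < ε) (y : Space d) :
    Measurable fun x => recompositionKernel ρ ε x y := by
  simp only [recompositionKernel_eq]
  exact (hρ.ennreal_ofReal.mul
    ((measurable_mollifierKernel hε).comp (measurable_id.const_sub y))).mul_const _

theorem measurable_prod_recompositionKernel_left (hρ : Measurable ρ) (hε : 0 < ε)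
    (Y : Config N d) :
    Measurable fun X : Config N d => ∏ i, recompositionKernel ρ ε (X i) (Y i) := by
  refine Finset.measurable_prod _ fun i _ => ?_
  exact (measurable_recompositionKernel_left hρ hε (Y i)).comp (Config.measurable_apply i)

theorem lintegral_recompositionKernel (y : Space d) :
    ∫⁻ x, recompositionKernel ρ ε x y = invMollifiedDensity ρ ε y * mollifiedDensity ρ ε y := by
  simp only [recompositionKernel_eq]
  rw [lintegral_mul_const' _ _ (invMollifiedDensity_ne_top y), mul_comm]
  rfl

variable {P : ProbabilityMeasure (Config N d)}

/-- Integration against the mollified plan. -/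
theorem lintegral_mollifiedPlanDensity_mul (hε : 0 < ε) {F : Config N d → ℝ≥0∞}
    (hF : Measurable F) :
    ∫⁻ Y, mollifiedPlanDensity P ε Y * F Y =
      ∫⁻ X, (∫⁻ Y : Config N d, (∏ i, mollifierKernel d ε (Y i - X i)) * F Y) ∂(P : Measure (Config N d)) := by
  have hm : Measurable fun p : Config N d × Config N d =>
      ∏ i, mollifierKernel d ε (p.1 i - p.2 i) :=
    measurable_prod_apply (F := fun x y => mollifierKernel d ε (x - y))
      (measurable_mollifierKernel_sub hε)
  exact lintegral_lintegral_mul_swap (ν := (P : Measure (Config N d)))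
    (A := fun Y X : Config N d => ∏ i, mollifierKernel d ε (Y i - X i)) hm hF

theorem lintegral_prod_mollifierKernel (hε : 0 < ε) (X : Config N d) :
    ∫⁻ Y : Config N d, ∏ i, mollifierKernel d ε (Y i - X i) = 1 := by
  rw [Config.lintegral_prod (f := fun i y => mollifierKernel d ε (y - X i)) fun i =>
    (measurable_mollifierKernel hε).comp (measurable_id.sub_const _)]
  exact Finset.prod_eq_one fun i _ => lintegral_scaledMollifier_sub_left hε (X i)

theorem lintegral_mollifiedPlanDensity (hε : 0 < ε) : ∫⁻ Y, mollifiedPlanDensity P ε Y = 1 := by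
  have := lintegral_mollifiedPlanDensity_mul (P := P) hε (F := fun _ => 1) measurable_const
  simpa [lintegral_prod_mollifierKernel hε] using this

/-- The marginals of the mollified plan are the mollified density. -/
theorem lintegral_mollifiedPlanDensity_mul_apply (hρ : Measurable ρ) (hP : P ∈ transportPlans N ρ)
    (hε : 0 < ε) {f : Space d → ℝ≥0∞} (hf : Measurable f) (i : Fin N) :
    ∫⁻ Y, mollifiedPlanDensity P ε Y * f (Y i) = ∫⁻ y, mollifiedDensity ρ ε y * f y := by
  have hk := measurable_mollifierKernel (d := d) hε
  have hfi : Measurable fun X : Config N d => f (X i) := hf.comp (Config.measurable_apply i)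
  have hkf : Measurable fun p : Space d × Space d => mollifierKernel d ε (p.2 - p.1) * f p.2 :=
    (hk.comp (measurable_snd.sub measurable_fst)).mul (hf.comp measurable_snd)
  rw [lintegral_mollifiedPlanDensity_mul hε hfi]
  have h1 : ∀ X : Config N d, ∫⁻ Y : Config N d, (∏ j, mollifierKernel d ε (Y j - X j)) * f (Y i)
      = ∫⁻ y, mollifierKernel d ε (y - X i) * f y := fun X => by
    -- Once f is absorbed into the i-th factor the integral splits, and the other factors have mass
    -- 1.
    have : ∀ Y : Config N d, (∏ j, mollifierKernel d ε (Y j - X j)) * f (Y i) =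
        ∏ j, mollifierKernel d ε (Y j - X j) * (if j = i then f (Y j) else 1) := fun Y => by
      rw [Finset.prod_mul_distrib, Finset.prod_ite_eq' Finset.univ i]
      simp
    simp only [this]
    rw [Config.lintegral_prod
      (f := fun j y => mollifierKernel d ε (y - X j) * (if j = i then f y else 1)),
      Finset.prod_eq_single i]
    · simp
    · intro j _ hj
      simpa [hj, mollifierKernel] using lintegral_scaledMollifier_sub_left hε (X j)
    · simp
    · intro j
      refine (hk.comp (measurable_id.sub_const _)).mul ?_
      by_cases hj : j = i
      · simpa [hj] using hf
      · simp [hj]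
  simp only [h1]
  have h2 := lintegral_map (μ := (P : Measure (Config N d)))
    (f := fun x => ∫⁻ y, mollifierKernel d ε (y - x) * f y)
    hkf.lintegral_prod_right' (Config.measurable_apply i)
  rw [← h2, hP i, lintegral_withDensity_eq_lintegral_mul _ hρ.ennreal_ofReal
    hkf.lintegral_prod_right']
  have h3 : ∀ x, ((fun x => ENNReal.ofReal (ρ x)) * fun x => ∫⁻ y, mollifierKernel d ε (y - x) * f y) x
      = ∫⁻ y, ENNReal.ofReal (ρ x) * (mollifierKernel d ε (y - x) * f y) := fun x => by
    rw [lintegral_const_mul' _ _ ENNReal.ofReal_ne_top, Pi.mul_apply]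
  simp only [h3]
  rw [lintegral_lintegral_swap]
  · refine lintegral_congr fun y => ?_
    simp only [← mul_assoc]
    rw [lintegral_mul_const]
    · rfl
    · exact hρ.ennreal_ofReal.mul (hk.comp (measurable_id.const_sub y))
  · exact ((hρ.comp measurable_fst).ennreal_ofReal.mul hkf).aemeasurable

/-- The mollified plan does not charge the zeros of the mollified density. -/
theorem ae_mollifiedDensity_ne_zero (hρ : Measurable ρ) (hP : P ∈ transportPlans N ρ)
    (hε : 0 < ε) : ∀ᵐ Y : Config N d, mollifiedPlanDensity P ε Y ≠ 0 →
      ∀ i, mollifiedDensity ρ ε (Y i) ≠ 0 := by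
  have hm := measurable_mollifiedDensity hρ hε
  have hs : MeasurableSet {y | mollifiedDensity ρ ε y = 0} := hm (measurableSet_singleton 0)
  have hi : Measurable ({y | mollifiedDensity ρ ε y = 0}.indicator fun _ => (1 : ℝ≥0∞)) :=
    measurable_const.indicator hs
  have h : ∀ i : Fin N, ∀ᵐ Y : Config N d, mollifiedPlanDensity P ε Y *
      {y | mollifiedDensity ρ ε y = 0}.indicator (fun _ => (1 : ℝ≥0∞)) (Y i) = 0 := fun i => by
    have hii : Measurable fun Y : Config N d =>
        {y | mollifiedDensity ρ ε y = 0}.indicator (fun _ => (1 : ℝ≥0∞)) (Y i) :=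
      hi.comp (Config.measurable_apply i)
    refine (lintegral_eq_zero_iff (f := fun Y : Config N d => mollifiedPlanDensity P ε Y *
      {y | mollifiedDensity ρ ε y = 0}.indicator (fun _ => (1 : ℝ≥0∞)) (Y i))
      ((measurable_mollifiedPlanDensity P hε).mul hii)).1 ?_
    -- The marginal identity reduces the claim to the integral of ρ_ε over its own zero set.
    rw [lintegral_mollifiedPlanDensity_mul_apply hρ hP hε hi]
    refine lintegral_eq_zero_of_ae_eq_zero (Eventually.of_forall fun y => ?_)
    by_cases hy : mollifiedDensity ρ ε y = 0 <;> simp [hy]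
  filter_upwards [ae_all_iff.2 h] with Y hY h0 i hi0
  rcases mul_eq_zero.1 (hY i) with h1 | h1
  · exact h0 h1
  · simp [hi0] at h1

theorem measurable_recomposition_integrand (P : ProbabilityMeasure (Config N d))
    (hρ : Measurable ρ) (hε : 0 < ε) : Measurable fun p : Config N d × Config N d =>
      mollifiedPlanDensity P ε p.2 * ∏ i, recompositionKernel ρ ε (p.1 i) (p.2 i) :=
  ((measurable_mollifiedPlanDensity P hε).comp measurable_snd).mul
    (measurable_prod_apply (measurable_recompositionKernel hρ hε))

theorem measurable_recomposedPlanDensity (P : ProbabilityMeasure (Config N d))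
    (hρ : Measurable ρ) (hε : 0 < ε) : Measurable (recomposedPlanDensity ρ P ε) :=
  (measurable_recomposition_integrand P hρ hε).lintegral_prod_right'

/-- Integration against the recomposed plan. -/
theorem lintegral_recomposedPlanDensity_mul (hρ : Measurable ρ) (hε : 0 < ε)
    {F : Config N d → ℝ≥0∞} (hF : Measurable F) :
    ∫⁻ X, recomposedPlanDensity ρ P ε X * F X =
      ∫⁻ Y, mollifiedPlanDensity P ε Y *
        ∫⁻ X : Config N d, (∏ i, recompositionKernel ρ ε (X i) (Y i)) * F X := by
  have hm := measurable_recomposition_integrand P hρ hε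
  have h1 := lintegral_lintegral_mul_swap (μ := volume) (ν := volume) (A := fun X Y : Config N d =>
    mollifiedPlanDensity P ε Y * ∏ i, recompositionKernel ρ ε (X i) (Y i)) hm hF
  have h2 : ∀ Y, ∫⁻ X : Config N d, (mollifiedPlanDensity P ε Y *
      ∏ i, recompositionKernel ρ ε (X i) (Y i)) * F X = mollifiedPlanDensity P ε Y *
        ∫⁻ X : Config N d, (∏ i, recompositionKernel ρ ε (X i) (Y i)) * F X := fun Y => by
    simp only [mul_assoc]
    rw [lintegral_const_mul' _ _ (mollifiedPlanDensity_ne_top P hε Y)]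
  simp only [h2] at h1
  exact h1

theorem lintegral_prod_recompositionKernel (hρ : Measurable ρ) (hε : 0 < ε) (Y : Config N d) :
    ∫⁻ X : Config N d, ∏ i, recompositionKernel ρ ε (X i) (Y i) =
      ∏ i, invMollifiedDensity ρ ε (Y i) * mollifiedDensity ρ ε (Y i) := by
  rw [Config.lintegral_prod (f := fun i x => recompositionKernel ρ ε x (Y i)) fun i =>
    measurable_recompositionKernel_left hρ hε (Y i)]
  simp only [lintegral_recompositionKernel]

theorem lintegral_recomposedPlanDensity (hρ : Measurable ρ)
    (hρ1 : ∫⁻ x, ENNReal.ofReal (ρ x) = 1) (hP : P ∈ transportPlans N ρ) (hε : 0 < ε) :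
    ∫⁻ X, recomposedPlanDensity ρ P ε X = 1 := by
  have := lintegral_recomposedPlanDensity_mul (P := P) hρ hε (F := fun _ => 1) measurable_const
  simp only [mul_one, lintegral_prod_recompositionKernel hρ hε] at this
  rw [this, ← lintegral_mollifiedPlanDensity (P := P) hε]
  refine lintegral_congr_ae ?_
  filter_upwards [ae_mollifiedDensity_ne_zero hρ hP hε] with Y hY
  by_cases h0 : mollifiedPlanDensity P ε Y = 0
  · simp [h0]
  · rw [Finset.prod_eq_one fun i _ => invMollifiedDensity_mul_of_ne_zero hρ1 hε (hY h0 i), mul_one]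

/-- The marginals of the recomposed plan. -/
theorem lintegral_recomposedPlanDensity_mul_apply (hρ : Measurable ρ)
    (hρ1 : ∫⁻ x, ENNReal.ofReal (ρ x) = 1) (hP : P ∈ transportPlans N ρ) (hε : 0 < ε)
    {f : Space d → ℝ≥0∞} (hf : Measurable f) (i : Fin N) :
    ∫⁻ X, recomposedPlanDensity ρ P ε X * f (X i) = ∫⁻ x, ENNReal.ofReal (ρ x) * f x := by
  have hk := measurable_mollifierKernel (d := d) hε
  have hfi : Measurable fun X : Config N d => f (X i) := hf.comp (Config.measurable_apply i)
  have hkern := measurable_recompositionKernel hρ hε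
  rw [lintegral_recomposedPlanDensity_mul hρ hε hfi]
  have hΓ : Measurable fun y => ∫⁻ x, recompositionKernel ρ ε x y * f x :=
    (hkern.mul (hf.comp measurable_fst)).lintegral_prod_left'
  have h1 : ∀ Y : Config N d,
      ∫⁻ X : Config N d, (∏ j, recompositionKernel ρ ε (X j) (Y j)) * f (X i) =
      ∏ j, if j = i then ∫⁻ x, recompositionKernel ρ ε x (Y j) * f x
        else invMollifiedDensity ρ ε (Y j) * mollifiedDensity ρ ε (Y j) := fun Y => by
    have : ∀ X : Config N d, (∏ j, recompositionKernel ρ ε (X j) (Y j)) * f (X i) =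
        ∏ j, recompositionKernel ρ ε (X j) (Y j) * (if j = i then f (X j) else 1) := fun X => by
      rw [Finset.prod_mul_distrib, Finset.prod_ite_eq' Finset.univ i]
      simp
    simp only [this]
    rw [Config.lintegral_prod
      (f := fun j x => recompositionKernel ρ ε x (Y j) * (if j = i then f x else 1))]
    · refine Finset.prod_congr rfl fun j _ => ?_
      by_cases hj : j = i
      · simp [hj]
      · simp [hj, lintegral_recompositionKernel]
    · intro j
      refine (measurable_recompositionKernel_left hρ hε (Y j)).mul ?_
      by_cases hj : j = i
      · simpa [hj] using hf
      · simp [hj]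
  have h2 : ∫⁻ Y : Config N d, mollifiedPlanDensity P ε Y *
        ∫⁻ X : Config N d, (∏ j, recompositionKernel ρ ε (X j) (Y j)) * f (X i) =
      ∫⁻ Y : Config N d, mollifiedPlanDensity P ε Y *
        ∫⁻ x, recompositionKernel ρ ε x (Y i) * f x := by
    refine lintegral_congr_ae ?_
    filter_upwards [ae_mollifiedDensity_ne_zero hρ hP hε] with Y hY
    by_cases h0 : mollifiedPlanDensity P ε Y = 0
    · simp [h0]
    · rw [h1, Finset.prod_eq_single i]
      · simp
      · intro j _ hj
        rw [if_neg hj, invMollifiedDensity_mul_of_ne_zero hρ1 hε (hY h0 j)]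
      · simp
  refine h2.trans ?_
  rw [lintegral_mollifiedPlanDensity_mul_apply hρ hP hε hΓ]
  have h3 : ∀ y, mollifiedDensity ρ ε y * ∫⁻ x, recompositionKernel ρ ε x y * f x =
      ∫⁻ x, mollifierKernel d ε (y - x) * (ENNReal.ofReal (ρ x) * f x) := fun y => by
    rw [← lintegral_const_mul' _ _ (mollifiedDensity_ne_top hρ1 hε y)]
    -- At a zero of ρ_ε the kernel is 0 by convention; the right side vanishes as well, since ρ(x)
    -- η_ε(y - x) = 0 for almost every x.
    by_cases h0 : mollifiedDensity ρ ε y = 0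
    · have h4 : ∀ᵐ x, ENNReal.ofReal (ρ x) * mollifierKernel d ε (y - x) = 0 :=
        (lintegral_eq_zero_iff (hρ.ennreal_ofReal.mul (hk.comp (measurable_id.const_sub y)))).1 h0
      refine lintegral_congr_ae ?_
      filter_upwards [h4] with x hx
      rw [h0, zero_mul, ← mul_assoc, mul_comm (mollifierKernel d ε _), hx, zero_mul]
    · refine lintegral_congr fun x => ?_
      rw [recompositionKernel_eq]
      calc _ = (invMollifiedDensity ρ ε y * mollifiedDensity ρ ε y) *
            (mollifierKernel d ε (y - x) * (ENNReal.ofReal (ρ x) * f x)) := by ring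
        _ = _ := by rw [invMollifiedDensity_mul_of_ne_zero hρ1 hε h0, one_mul]
  simp only [h3]
  rw [lintegral_lintegral_swap]
  · refine lintegral_congr fun x => ?_
    have hx : Measurable fun y => mollifierKernel d ε (y - x) :=
      hk.comp (measurable_id.sub_const x)
    rw [lintegral_mul_const _ hx]
    have := lintegral_scaledMollifier_sub_left hε x
    rw [show ∫⁻ y, mollifierKernel d ε (y - x) = 1 from this, one_mul]
  · exact ((hk.comp (measurable_fst.sub measurable_snd)).mul
      ((hρ.comp measurable_snd).ennreal_ofReal.mul (hf.comp measurable_snd))).aemeasurable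

/-- Recomposition displaces every particle by less than `2ε`. -/
theorem lintegral_recomposedPlanDensity_mul_le (hρ : Measurable ρ) (hε : 0 < ε)
    {f F : Config N d → ℝ≥0∞} (hf : Measurable f)
    (h : ∀ᵐ X ∂(P : Measure (Config N d)), ∀ X' : Config N d,
      (∀ i, ‖X' i - X i‖ < 2 * ε) → f X' ≤ F X) :
    ∫⁻ X, recomposedPlanDensity ρ P ε X * f X ≤ ∫⁻ X, F X ∂(P : Measure (Config N d)) := by
  have hkern : Measurable fun p : Config N d × Config N d =>
      ∏ i, recompositionKernel ρ ε (p.1 i) (p.2 i) :=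
    measurable_prod_apply (measurable_recompositionKernel hρ hε)
  have hI : Measurable fun Y : Config N d =>
      ∫⁻ X : Config N d, (∏ i, recompositionKernel ρ ε (X i) (Y i)) * f X :=
    (hkern.mul (hf.comp measurable_fst)).lintegral_prod_left'
  rw [lintegral_recomposedPlanDensity_mul hρ hε hf, lintegral_mollifiedPlanDensity_mul hε hI]
  refine lintegral_mono_ae ?_
  filter_upwards [h] with X hX
  calc _ ≤ ∫⁻ Y : Config N d, (∏ i, mollifierKernel d ε (Y i - X i)) * F X := by
        refine lintegral_mono fun Y => ?_
        by_cases h0 : ∏ i, mollifierKernel d ε (Y i - X i) = 0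
        · simp [h0]
        refine mul_le_mul_right ?_ _
        calc _ ≤ ∫⁻ X' : Config N d, (∏ i, recompositionKernel ρ ε (X' i) (Y i)) * F X := by
              refine lintegral_mono fun X' => ?_
              by_cases h1 : ∏ i, recompositionKernel ρ ε (X' i) (Y i) = 0
              · simp [h1]
              refine mul_le_mul_right (hX X' fun i => ?_) _
              -- On the support of the kernels, x_i and x'_i both lie within ε of y_i; hence the 2ε.
              have h2 := norm_lt_of_mollifierKernel_ne_zero hε
                (Finset.prod_ne_zero_iff.1 h0 i (Finset.mem_univ i))
              have h3 := Finset.prod_ne_zero_iff.1 h1 i (Finset.mem_univ i)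
              rw [recompositionKernel_eq] at h3
              have h4 := norm_lt_of_mollifierKernel_ne_zero hε
                (right_ne_zero_of_mul (left_ne_zero_of_mul h3))
              rw [← norm_sub_rev] at h4
              have h5 := norm_sub_le_norm_sub_add_norm_sub (X' i) (Y i) (X i)
              linarith
          _ = (∏ i, invMollifiedDensity ρ ε (Y i) * mollifiedDensity ρ ε (Y i)) * F X := by
              rw [lintegral_mul_const _ (measurable_prod_recompositionKernel_left hρ hε Y),
                lintegral_prod_recompositionKernel hρ hε]
          _ ≤ 1 * F X :=
              mul_le_mul' (prod_invMollifiedDensity_mul_le Y) le_rfl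
          _ = F X := one_mul _
    _ = F X := by
        rw [lintegral_mul_const, lintegral_prod_mollifierKernel hε, one_mul]
        refine Finset.measurable_prod _ fun i _ => ?_
        exact (measurable_mollifierKernel hε).comp ((Config.measurable_apply i).sub_const _)

end Recomposition

/-! ### Reduction of the N-particle energy to one particle -/

theorem lintegral_lintegral_finset_sum {α β ι : Type*} [MeasurableSpace α] [MeasurableSpace β]
    {μ : Measure α} {ν : Measure β} [SFinite ν] (s : Finset ι) {A : ι → α → β → ℝ≥0∞}
    (hA : ∀ i, Measurable fun p : α × β => A i p.1 p.2) :
    ∫⁻ x, ∫⁻ y, ∑ i ∈ s, A i x y ∂ν ∂μ = ∑ i ∈ s, ∫⁻ x, ∫⁻ y, A i x y ∂ν ∂μ := by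
  rw [← lintegral_finsetSum _ fun i _ => (hA i).lintegral_prod_right']
  refine lintegral_congr fun x => lintegral_finsetSum _ fun i _ => ?_
  exact (hA i).comp (measurable_prodMk_left (x := x))

section Energy

variable {N d : ℕ} {ε : ℝ} {ρ : Space d → ℝ} {P : ProbabilityMeasure (Config N d)}

/-- The quotient `P̃_ε(Y) / ∏ ρ_ε(y_i)`. -/
noncomputable def recompositionWeight (ρ : Space d → ℝ) (P : ProbabilityMeasure (Config N d))
    (ε : ℝ) (Y : Config N d) : ℝ :=
  (mollifiedPlanDensity P ε Y * ∏ i, invMollifiedDensity ρ ε (Y i)).toReal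

theorem recompositionWeight_nonneg (Y : Config N d) : 0 ≤ recompositionWeight ρ P ε Y :=
  ENNReal.toReal_nonneg

theorem ofReal_recompositionWeight (hε : 0 < ε) (Y : Config N d) :
    ENNReal.ofReal (recompositionWeight ρ P ε Y) =
      mollifiedPlanDensity P ε Y * ∏ i, invMollifiedDensity ρ ε (Y i) :=
  ENNReal.ofReal_toReal (ENNReal.mul_ne_top (mollifiedPlanDensity_ne_top P hε Y)
    (ENNReal.prod_ne_top fun i _ => invMollifiedDensity_ne_top (Y i)))

theorem measurable_prod_invMollifiedDensity (hρ : Measurable ρ) (hε : 0 < ε) :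
    Measurable fun Y : Config N d => ∏ i, invMollifiedDensity ρ ε (Y i) := by
  refine Finset.measurable_prod _ fun i _ => ?_
  exact (measurable_invMollifiedDensity hρ hε).comp (Config.measurable_apply i)

theorem measurable_recompositionWeight (hρ : Measurable ρ) (hε : 0 < ε) :
    Measurable (recompositionWeight ρ P ε) :=
  ((measurable_mollifiedPlanDensity P hε).mul
    (measurable_prod_invMollifiedDensity hρ hε)).ennreal_toReal

/-- Both sides send negative numbers to 0. No sign is needed, which matters because ρ is nonnegative
only almost everywhere. -/
theorem ofReal_sqrt_sq (x : ℝ) : ENNReal.ofReal (√x ^ 2) = ENNReal.ofReal x := by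
  rcases le_total 0 x with h | h
  · rw [Real.sq_sqrt h]
  · rw [Real.sqrt_eq_zero_of_nonpos h, ENNReal.ofReal_of_nonpos h]; simp

/-- The factors ρ(x_i) leave the Y-integral and the reciprocals of ρ_ε(y_i) join P̃_ε in the weight.
Evenness of η_ε makes the rest a convolution with the square of the tensorised root. -/
theorem recomposedPlanDensity_eq (hε : 0 < ε) (X : Config N d) :
    recomposedPlanDensity ρ P ε X =
      ‖Config.tensor (fun x => √(ρ x)) X‖ₑ ^ 2 *
        sqConv (recompositionWeight ρ P ε) (Config.tensor (sqrtMollifier d ε)) X := by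
  have h1 : ‖Config.tensor (fun x => √(ρ x)) X‖ₑ ^ 2 = ∏ i, ENNReal.ofReal (ρ (X i)) := by
    rw [← ofReal_norm, ← ENNReal.ofReal_pow (norm_nonneg _), Real.norm_eq_abs, sq_abs,
      Config.tensor, ← Finset.prod_pow, ENNReal.ofReal_prod_of_nonneg fun i _ => sq_nonneg _]
    simp only [ofReal_sqrt_sq]
  have h2 : (∏ i, ENNReal.ofReal (ρ (X i))) ≠ ⊤ :=
    ENNReal.prod_ne_top fun i _ => ENNReal.ofReal_ne_top
  rw [h1, sqConv, ← lintegral_const_mul' _ _ h2]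
  refine lintegral_congr fun Y => ?_
  simp only [recompositionKernel_eq]
  rw [ENNReal.ofReal_mul (recompositionWeight_nonneg Y), ofReal_recompositionWeight hε,
    Config.tensor, Real.norm_eq_abs, sq_abs, ← Finset.prod_pow,
    ENNReal.ofReal_prod_of_nonneg fun i _ => sq_nonneg _, Finset.prod_mul_distrib,
    Finset.prod_mul_distrib]
  have h3 : ∀ i, ENNReal.ofReal (sqrtMollifier d ε ((X - Y) i) ^ 2) =
      mollifierKernel d ε (Y i - X i) := fun i => by
    rw [sqrtMollifier_sq hε, ← mollifierKernel_sub_comm]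
    rfl
  simp only [h3]
  ring

/-- The i-th component is the one-particle expression times the factors of all other particles, so
its square is again a product over particles. -/
theorem Config.norm_localization_sq (f t : Space d → ℝ) (G t' : Space d → Space d)
    (X Z : Config N d) :
    ‖Config.tensor t Z • Config.tensorGrad f G X + Config.tensor f X • Config.tensorGrad t t' Z‖ ^ 2
      = ∑ i, ∏ j, if j = i then ‖t (Z j) • G (X j) + f (X j) • t' (Z j)‖ ^ 2
        else f (X j) ^ 2 * t (Z j) ^ 2 := by
  rw [PiLp.norm_sq_eq_of_L2]
  refine Finset.sum_congr rfl fun i _ => ?_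
  rw [← Config.prod_erase_mul (fun j => f (X j) ^ 2 * t (Z j) ^ 2)
    (fun j => ‖t (Z j) • G (X j) + f (X j) • t' (Z j)‖ ^ 2) i]
  have h : (Config.tensor t Z • Config.tensorGrad f G X +
      Config.tensor f X • Config.tensorGrad t t' Z) i =
      ((∏ j ∈ Finset.univ.erase i, f (X j)) * ∏ j ∈ Finset.univ.erase i, t (Z j)) •
        (t (Z i) • G (X i) + f (X i) • t' (Z i)) := by
    simp only [PiLp.add_apply, PiLp.smul_apply, Config.tensorGrad, Config.tensor]
    rw [← Finset.prod_erase_mul _ (fun j => t (Z j)) (Finset.mem_univ i),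
      ← Finset.prod_erase_mul _ (fun j => f (X j)) (Finset.mem_univ i)]
    module
  rw [h, norm_smul, mul_pow, Real.norm_eq_abs, sq_abs, mul_pow, ← Finset.prod_pow,
    ← Finset.prod_pow, ← Finset.prod_mul_distrib]

theorem measurable_recomposition_apply (hρ : Measurable ρ) (hε : 0 < ε)
    {B : Space d → Space d → ℝ≥0∞} (hB : Measurable fun q : Space d × Space d => B q.1 q.2)
    (i : Fin N) : Measurable fun p : Config N d × Config N d =>
      (mollifiedPlanDensity P ε p.2 * ∏ j, invMollifiedDensity ρ ε (p.2 j)) *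
        ∏ j, (if j = i then B (p.1 j) (p.2 j)
          else ENNReal.ofReal (ρ (p.1 j)) * mollifierKernel d ε (p.2 j - p.1 j)) := by
  have hW : Measurable fun Y : Config N d =>
      mollifiedPlanDensity P ε Y * ∏ j, invMollifiedDensity ρ ε (Y j) :=
    (measurable_mollifiedPlanDensity P hε).mul (measurable_prod_invMollifiedDensity hρ hε)
  have hF : ∀ j, Measurable fun q : Space d × Space d => if j = i then B q.1 q.2
      else ENNReal.ofReal (ρ q.1) * mollifierKernel d ε (q.2 - q.1) := fun j => by
    by_cases hj : j = i
    · simpa [hj] using hB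
    · simp only [hj, if_false]
      exact (hρ.comp measurable_fst).ennreal_ofReal.mul
        ((measurable_mollifierKernel hε).comp (measurable_snd.sub measurable_fst))
  refine (hW.comp measurable_snd).mul (Finset.measurable_prod _ fun j _ => ?_)
  have h : Measurable fun p : Config N d × Config N d => (p.1 j, p.2 j) :=
    ((Config.measurable_apply j).comp measurable_fst).prodMk
      ((Config.measurable_apply j).comp measurable_snd)
  exact (hF j).comp h

/-- Integration of a function of the `i`-th particle before and after recomposition. -/
theorem lintegral_recomposition_apply_le (hρ : Measurable ρ) (hP : P ∈ transportPlans N ρ)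
    (hε : 0 < ε) {B : Space d → Space d → ℝ≥0∞}
    (hB : Measurable fun q : Space d × Space d => B q.1 q.2) (i : Fin N) :
    ∫⁻ X : Config N d, ∫⁻ Y : Config N d,
      (mollifiedPlanDensity P ε Y * ∏ j, invMollifiedDensity ρ ε (Y j)) *
        ∏ j, (if j = i then B (X j) (Y j)
          else ENNReal.ofReal (ρ (X j)) * mollifierKernel d ε (Y j - X j)) ≤
      ∫⁻ x, ∫⁻ y, B x y := by
  have hWt : ∀ Y : Config N d,
      mollifiedPlanDensity P ε Y * ∏ j, invMollifiedDensity ρ ε (Y j) ≠ ⊤ := fun Y =>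
    ENNReal.mul_ne_top (mollifiedPlanDensity_ne_top P hε Y)
      (ENNReal.prod_ne_top fun i _ => invMollifiedDensity_ne_top (Y i))
  have hm := measurable_recomposition_apply (P := P) hρ hε hB i
  have hBl : ∀ y, Measurable fun x => B x y := fun y => hB.comp measurable_prodMk_right
  have hΓ : Measurable fun y => ∫⁻ x, B x y := hB.lintegral_prod_left'
  have hκ := measurable_invMollifiedDensity hρ hε
  rw [lintegral_lintegral_swap hm.aemeasurable]
  have h1 : ∀ Y : Config N d, ∫⁻ X : Config N d,
      (mollifiedPlanDensity P ε Y * ∏ j, invMollifiedDensity ρ ε (Y j)) *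
        ∏ j, (if j = i then B (X j) (Y j)
          else ENNReal.ofReal (ρ (X j)) * mollifierKernel d ε (Y j - X j)) ≤
      mollifiedPlanDensity P ε Y * (invMollifiedDensity ρ ε (Y i) * ∫⁻ x, B x (Y i)) := fun Y => by
    rw [lintegral_const_mul' _ _ (hWt Y), mul_assoc]
    refine mul_le_mul_right ?_ _
    rw [Config.lintegral_prod (f := fun j x => if j = i then B x (Y j)
      else ENNReal.ofReal (ρ x) * mollifierKernel d ε (Y j - x)), ← Finset.prod_mul_distrib,
      ← Finset.mul_prod_erase _ _ (Finset.mem_univ i)]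
    -- Each reciprocal of ρ_ε(y_j) meets ∫ ρ(x) η_ε(y_j - x) dx = ρ_ε(y_j).
    · have h2 : ∏ j ∈ Finset.univ.erase i, (invMollifiedDensity ρ ε (Y j) *
          ∫⁻ x, if j = i then B x (Y j)
            else ENNReal.ofReal (ρ x) * mollifierKernel d ε (Y j - x)) ≤ 1 := by
        refine (Finset.prod_le_pow_card _ _ 1 fun j hj => ?_).trans (by simp)
        simp only [Finset.ne_of_mem_erase hj, if_false]
        exact invMollifiedDensity_mul_le (Y j)
      refine (mul_le_mul' le_rfl h2).trans ?_
      simp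
    · intro j
      by_cases hj : j = i
      · simpa [hj] using hBl (Y i)
      · simp only [hj, if_false]
        exact hρ.ennreal_ofReal.mul
          ((measurable_mollifierKernel hε).comp (measurable_id.const_sub (Y j)))
  refine (lintegral_mono h1).trans ?_
  -- The i-th marginal of P̃_ε supplies the factor ρ_ε(y) that cancels the last reciprocal.
  rw [lintegral_mollifiedPlanDensity_mul_apply hρ hP hε (hκ.mul hΓ)
    (f := fun y => invMollifiedDensity ρ ε y * ∫⁻ x, B x y)]
  rw [lintegral_lintegral_swap hB.aemeasurable]
  refine lintegral_mono fun y => ?_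
  rw [← mul_assoc, mul_comm (mollifiedDensity ρ ε y)]
  exact (mul_le_mul' (invMollifiedDensity_mul_le y) le_rfl).trans (one_mul _).le

/-- The fields `G` and `t'` are left arbitrary so that either may be set to 0; those special cases
provide the integrability needed before the true gradients are inserted. -/
theorem lintegral_norm_localization_le (hρ : Measurable ρ) (hP : P ∈ transportPlans N ρ)
    (hε : 0 < ε) {G t' : Space d → Space d} (hG : Measurable G) (ht' : Measurable t') :
    ∫⁻ X : Config N d, ∫⁻ Y, ENNReal.ofReal (recompositionWeight ρ P ε Y *
      ‖Config.tensor (sqrtMollifier d ε) (X - Y) • Config.tensorGrad (fun x => √(ρ x)) G X +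
        Config.tensor (fun x => √(ρ x)) X •
          Config.tensorGrad (sqrtMollifier d ε) t' (X - Y)‖ ^ 2) ≤
      N * ∫⁻ x, ∫⁻ y, ENNReal.ofReal (‖sqrtMollifier d ε (x - y) • G x +
        √(ρ x) • t' (x - y)‖ ^ 2) := by
  have ht := (contDiff_sqrtMollifier (d := d) hε).continuous.measurable
  set B : Space d → Space d → ℝ≥0∞ := fun x y =>
    ENNReal.ofReal (‖sqrtMollifier d ε (x - y) • G x + √(ρ x) • t' (x - y)‖ ^ 2) with hBdef
  have hs : Measurable fun q : Space d × Space d => q.1 - q.2 := measurable_fst.sub measurable_snd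
  have hB : Measurable fun q : Space d × Space d => B q.1 q.2 :=
    ((((ht.comp hs).smul (hG.comp measurable_fst)).add
      ((hρ.comp measurable_fst).sqrt.smul (ht'.comp hs))).norm.pow_const 2).ennreal_ofReal
  have h1 : ∀ X Y : Config N d, ENNReal.ofReal (recompositionWeight ρ P ε Y *
      ‖Config.tensor (sqrtMollifier d ε) (X - Y) • Config.tensorGrad (fun x => √(ρ x)) G X +
        Config.tensor (fun x => √(ρ x)) X •
          Config.tensorGrad (sqrtMollifier d ε) t' (X - Y)‖ ^ 2) =
      ∑ i, (mollifiedPlanDensity P ε Y * ∏ j, invMollifiedDensity ρ ε (Y j)) *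
        ∏ j, (if j = i then B (X j) (Y j)
          else ENNReal.ofReal (ρ (X j)) * mollifierKernel d ε (Y j - X j)) := fun X Y => by
    have h0 : ∀ i j : Fin N, 0 ≤ (if j = i then
        ‖sqrtMollifier d ε ((X - Y) j) • G (X j) + √(ρ (X j)) • t' ((X - Y) j)‖ ^ 2
        else √(ρ (X j)) ^ 2 * sqrtMollifier d ε ((X - Y) j) ^ 2) := fun i j => by
      split_ifs <;> positivity
    rw [ENNReal.ofReal_mul (recompositionWeight_nonneg Y), ofReal_recompositionWeight hε,
      Config.norm_localization_sq, ENNReal.ofReal_sum_of_nonneg, Finset.mul_sum]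
    · refine Finset.sum_congr rfl fun i _ => ?_
      rw [ENNReal.ofReal_prod_of_nonneg fun j _ => h0 i j]
      congr 1
      refine Finset.prod_congr rfl fun j _ => ?_
      by_cases hj : j = i
      · simp [hj, hBdef]
      · simp only [hj, if_false]
        rw [ENNReal.ofReal_mul (sq_nonneg _), ofReal_sqrt_sq, sqrtMollifier_sq hε,
          ← mollifierKernel_sub_comm]
        rfl
    · exact fun i _ => Finset.prod_nonneg fun j _ => h0 i j
  simp only [h1]
  rw [lintegral_lintegral_finset_sum Finset.univ (A := fun i (X Y : Config N d) =>
    (mollifiedPlanDensity P ε Y * ∏ j, invMollifiedDensity ρ ε (Y j)) *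
        ∏ j, (if j = i then B (X j) (Y j)
          else ENNReal.ofReal (ρ (X j)) * mollifierKernel d ε (Y j - X j)))
    fun i => measurable_recomposition_apply hρ hε hB i]
  calc _ ≤ ∑ i : Fin N, ∫⁻ x, ∫⁻ y, B x y := Finset.sum_le_sum fun i _ =>
        lintegral_recomposition_apply_le hρ hP hε hB i
    _ = _ := by rw [Finset.sum_const, Finset.card_univ, Fintype.card_fin, nsmul_eq_mul]

end Energy

/-! ### The amplitude: Sobolev regularity and kinetic energy -/

section WeakGrad

variable {V : Type*} [NormedAddCommGroup V] [InnerProductSpace ℝ V] [FiniteDimensional ℝ V]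
  [MeasurableSpace V] [BorelSpace V]

theorem HasWeakGradient.weakGrad_ae_eq {f : V → ℝ} {G : V → V} (h : HasWeakGradient f G) :
    weakGrad f =ᵐ[volume] G := by
  have he : ∃ G : V → V, HasWeakGradient f G := ⟨G, h⟩
  rw [weakGrad, dif_pos he]
  exact he.choose_spec.ae_eq h

theorem HasWeakGradient.integral_norm_weakGrad_sq {f : V → ℝ} {G : V → V}
    (h : HasWeakGradient f G) : ∫ x, ‖weakGrad f x‖ ^ 2 = ∫ x, ‖G x‖ ^ 2 :=
  integral_congr_ae (by filter_upwards [h.weakGrad_ae_eq] with x hx; rw [hx])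

end WeakGrad

section Recomposition

variable {N d : ℕ} {ε : ℝ} {ρ : Space d → ℝ} {P : ProbabilityMeasure (Config N d)}

/-- The square root of the density of the recomposed plan. -/
noncomputable def recomposedAmplitude (ρ : Space d → ℝ) (P : ProbabilityMeasure (Config N d))
    (ε : ℝ) (X : Config N d) : ℝ :=
  Config.tensor (fun x => √(ρ x)) X *
    √(sqConv (recompositionWeight ρ P ε) (Config.tensor (sqrtMollifier d ε)) X).toReal

/-- Only almost everywhere: `toReal` loses an infinite value of the density, but total mass 1
confines such points to a null set. -/
theorem ofReal_recomposedAmplitude_sq (hρ : Measurable ρ)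
    (hρ1 : ∫⁻ x, ENNReal.ofReal (ρ x) = 1) (hP : P ∈ transportPlans N ρ) (hε : 0 < ε) :
    (fun X => ENNReal.ofReal (recomposedAmplitude ρ P ε X ^ 2)) =ᵐ[volume]
      recomposedPlanDensity ρ P ε := by
  have hfin : ∫⁻ X, recomposedPlanDensity ρ P ε X ≠ ⊤ := by
    rw [lintegral_recomposedPlanDensity hρ hρ1 hP hε]; simp
  filter_upwards [ae_lt_top (measurable_recomposedPlanDensity P hρ hε) hfin] with X hX
  rw [← ENNReal.ofReal_toReal hX.ne, recomposedPlanDensity_eq hε, ENNReal.toReal_mul,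
    ENNReal.toReal_pow, toReal_enorm, Real.norm_eq_abs, sq_abs, recomposedAmplitude, mul_pow,
    Real.sq_sqrt ENNReal.toReal_nonneg]

theorem Config.tensorGrad_zero (f : Space d → ℝ) (X : Config N d) :
    Config.tensorGrad f (fun _ => 0) X = 0 := by
  ext i : 1
  simp [Config.tensorGrad]

theorem recomposedAmplitude_spec (hρ : Measurable ρ)
    (hρ1 : ∫⁻ x, ENNReal.ofReal (ρ x) = 1) (hP : P ∈ transportPlans N ρ) (hε : 0 < ε)
    {G : Space d → Space d} (hG : Measurable G) (hw : HasWeakGradient (fun x => √(ρ x)) G)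
    (hG2 : MemLp G 2 volume) :
    MemH1 (recomposedAmplitude ρ P ε) ∧
      ∫ X, ‖weakGrad (recomposedAmplitude ρ P ε) X‖ ^ 2 ≤
        N * ((∫ x, ‖G x‖ ^ 2) + mollifierEnergy d / ε ^ 2) := by
  set f : Space d → ℝ := fun x => √(ρ x) with hfdef
  have hfm : Measurable f := hρ.sqrt
  have hf1 : ∫⁻ x, ENNReal.ofReal (f x ^ 2) = 1 := by simpa only [hfdef, ofReal_sqrt_sq] using hρ1
  have hfi : Integrable fun x => f x ^ 2 := by
    refine (lintegral_ofReal_ne_top_iff_integrable (hfm.pow_const 2).aestronglyMeasurable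
      (Eventually.of_forall fun x => sq_nonneg _)).1 ?_
    rw [hf1]; simp
  have hf1' : ∫ x, f x ^ 2 = 1 := by
    rw [integral_eq_lintegral_of_nonneg_ae (Eventually.of_forall fun x => sq_nonneg _)
      (hfm.pow_const 2).aestronglyMeasurable, hf1, ENNReal.toReal_one]
  have hf2 : MemLp f 2 volume := (memLp_two_iff_integrable_sq hfm.aestronglyMeasurable).2 hfi
  set t := sqrtMollifier d ε with ht
  set t' := gradient (sqrtMollifier d ε) with ht'
  set T : Config N d → ℝ := Config.tensor t with hT
  set T' : Config N d → Config N d := Config.tensorGrad t t' with hT'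
  set R : Config N d → ℝ := Config.tensor f with hR
  set S : Config N d → Config N d := Config.tensorGrad f G with hS
  set g := recompositionWeight ρ P ε with hg
  have hgm : Measurable g := measurable_recompositionWeight hρ hε
  have hg0 : ∀ Y, 0 ≤ g Y := recompositionWeight_nonneg
  have hTs : ContDiff ℝ ∞ T := Config.contDiff_tensor (contDiff_sqrtMollifier hε)
  have hTc : HasCompactSupport T :=
    Config.hasCompactSupport_tensor (hasCompactSupport_sqrtMollifier hε)
  have hTg : ∀ X, HasGradientAt T (T' X) X :=
    Config.hasGradientAt_tensor (hasGradientAt_sqrtMollifier hε)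
  have ht'm : Measurable t' := (continuous_gradient_sqrtMollifier hε).measurable
  have hT'c : Continuous T' := continuous_gradient hTs hTg
  have hRw : HasWeakGradient R S := Config.hasWeakGradient_tensor hw hf2 hG2
  have hHm : Measurable (sqConv g T) := measurable_sqConv hgm hTs.continuous
  have hKm : Measurable (sqConv g T') := measurable_sqConv hgm hT'c
  have k1 : ∫⁻ X, ‖R X‖ₑ ^ 2 * sqConv g T X ≠ ⊤ := by
    have : ∫⁻ X, ‖R X‖ₑ ^ 2 * sqConv g T X = ∫⁻ X, recomposedPlanDensity ρ P ε X :=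
      lintegral_congr fun X => (recomposedPlanDensity_eq hε X).symm
    rw [this, lintegral_recomposedPlanDensity hρ hρ1 hP hε]
    simp
  have hGi : Integrable fun x => ‖G x‖ ^ 2 :=
    (memLp_two_iff_integrable_sq_norm hG.aestronglyMeasurable).1 hG2
  have k2 : ∫⁻ X, ‖S X‖ₑ ^ 2 * sqConv g T X ≠ ⊤ := by
    -- Suppressing the gradient of the mollifier isolates the term ‖S‖² (g ⋆ T²).
    have h := lintegral_norm_localization_le (P := P) hρ hP hε hG (t' := fun _ => 0) measurable_const
    have e1 : ∫⁻ X, ‖S X‖ₑ ^ 2 * sqConv g T X = ∫⁻ X, ∫⁻ Y, ENNReal.ofReal (g Y *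
        ‖T (X - Y) • S X + R X • Config.tensorGrad t (fun _ => 0) (X - Y)‖ ^ 2) := by
      refine lintegral_congr fun X => ?_
      rw [sqConv, ← lintegral_const_mul' _ _ (by simp)]
      refine lintegral_congr fun Y => ?_
      rw [Config.tensorGrad_zero, smul_zero, add_zero, norm_smul, ← ofReal_norm,
        ← ENNReal.ofReal_pow (norm_nonneg _), ← ENNReal.ofReal_mul (by positivity)]
      congr 1
      ring
    have e2 : ∀ x, ∫⁻ y, ENNReal.ofReal (‖t (x - y) • G x + √(ρ x) • (0 : Space d)‖ ^ 2) =
        ENNReal.ofReal (‖G x‖ ^ 2) := fun x => by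
      have := lintegral_norm_localization_sq hε (G x) 0 x
      simpa using this
    rw [e1]
    refine ne_top_of_le_ne_top ?_ h
    refine ENNReal.mul_ne_top (by simp) ?_
    simp only [← ht, e2]
    exact (lintegral_ofReal_ne_top_iff_integrable hGi.aestronglyMeasurable
      (Eventually.of_forall fun x => by positivity)).2 hGi
  have k3 : ∫⁻ X, ‖R X‖ₑ ^ 2 * sqConv g T' X ≠ ⊤ := by
    -- Suppressing ∇√ρ isolates the term R² (g ⋆ ‖T'‖²).
    have h := lintegral_norm_localization_le (P := P) hρ hP hε (G := fun _ => 0) measurable_const ht'm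
    have e1 : ∫⁻ X, ‖R X‖ₑ ^ 2 * sqConv g T' X = ∫⁻ X, ∫⁻ Y, ENNReal.ofReal (g Y *
        ‖T (X - Y) • Config.tensorGrad f (fun _ => 0) X + R X • T' (X - Y)‖ ^ 2) := by
      refine lintegral_congr fun X => ?_
      rw [sqConv, ← lintegral_const_mul' _ _ (by simp)]
      refine lintegral_congr fun Y => ?_
      rw [Config.tensorGrad_zero, smul_zero, zero_add, norm_smul, ← ofReal_norm,
        ← ENNReal.ofReal_pow (norm_nonneg _), ← ENNReal.ofReal_mul (by positivity)]
      congr 1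
      ring
    have e2 : ∀ x, ∫⁻ y, ENNReal.ofReal (‖t (x - y) • (0 : Space d) + √(ρ x) • t' (x - y)‖ ^ 2) =
        ENNReal.ofReal (f x ^ 2 * (mollifierEnergy d / ε ^ 2)) := fun x => by
      have := lintegral_norm_localization_sq hε (0 : Space d) (f x) x
      rw [norm_zero, zero_pow two_ne_zero, zero_add] at this
      exact this
    rw [e1]
    refine ne_top_of_le_ne_top ?_ h
    refine ENNReal.mul_ne_top (by simp) ?_
    simp only [← ht, e2]
    have hi := hfi.mul_const (mollifierEnergy d / ε ^ 2)
    have := mollifierEnergy_nonneg (d := d)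
    exact (lintegral_ofReal_ne_top_iff_integrable hi.aestronglyMeasurable
      (Eventually.of_forall fun x => by positivity)).2 hi
  obtain ⟨a1, m1⟩ := memLp_norm_mul_sqrt hRw.locallyIntegrable.aestronglyMeasurable
    hHm.aemeasurable k1
  obtain ⟨a2, m2⟩ := memLp_norm_mul_sqrt hRw.locallyIntegrable_grad.aestronglyMeasurable
    hHm.aemeasurable k2
  obtain ⟨a3, m3⟩ := memLp_norm_mul_sqrt hRw.locallyIntegrable.aestronglyMeasurable
    hKm.aemeasurable k3
  have key : HasWeakGradient (recomposedAmplitude ρ P ε) (gradMulSqrtConv R S g T T') :=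
    hasWeakGradient_mul_sqrt_sqConv hRw hTs hTc hTg hgm hg0 a1 a2 a3
      (m1.locallyIntegrable (by norm_num)) (m2.locallyIntegrable (by norm_num))
      (m3.locallyIntegrable (by norm_num))
  have hΦm := key.locallyIntegrable_grad.aestronglyMeasurable
  have hbound : ∫⁻ X, ENNReal.ofReal (‖gradMulSqrtConv R S g T T' X‖ ^ 2) ≤
      ENNReal.ofReal (N * ((∫ x, ‖G x‖ ^ 2) + mollifierEnergy d / ε ^ 2)) := by
    calc _ ≤ ∫⁻ X, ∫⁻ Y, ENNReal.ofReal (g Y * ‖T (X - Y) • S X + R X • T' (X - Y)‖ ^ 2) := by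
          refine lintegral_mono_ae ?_
          filter_upwards [a1, a2, a3] with X h1 h2 h3
          exact enorm_gradMulSqrtConv_sq_le hTs.continuous hT'c hgm hg0 h1 h2 h3
      _ ≤ N * ∫⁻ x, ∫⁻ y, ENNReal.ofReal (‖t (x - y) • G x + f x • t' (x - y)‖ ^ 2) :=
          lintegral_norm_localization_le (P := P) hρ hP hε hG ht'm
      _ = N * ∫⁻ x, ENNReal.ofReal (‖G x‖ ^ 2 + f x ^ 2 * (mollifierEnergy d / ε ^ 2)) := by
          congr 1
          exact lintegral_congr fun x => lintegral_norm_localization_sq hε (G x) (f x) x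
      _ = _ := by
          have hi := hfi.mul_const (mollifierEnergy d / ε ^ 2)
          have := mollifierEnergy_nonneg (d := d)
          have hsum : Integrable fun x => ‖G x‖ ^ 2 + f x ^ 2 * (mollifierEnergy d / ε ^ 2) :=
            hGi.add hi
          rw [← ofReal_integral_eq_lintegral_ofReal hsum
            (Eventually.of_forall fun x => by positivity), ENNReal.ofReal_mul (by positivity),
            ENNReal.ofReal_natCast]
          rw [integral_add hGi hi, integral_mul_const, hf1', one_mul]
  have hnn : 0 ≤ᵐ[volume] fun X => ‖gradMulSqrtConv R S g T T' X‖ ^ 2 :=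
    Eventually.of_forall fun X => by positivity
  have hΦ2 : Integrable fun X => ‖gradMulSqrtConv R S g T T' X‖ ^ 2 :=
    (lintegral_ofReal_ne_top_iff_integrable (hΦm.norm.pow 2) hnn).1
      (ne_top_of_le_ne_top ENNReal.ofReal_ne_top hbound)
  refine ⟨⟨?_, _, key, (memLp_two_iff_integrable_sq_norm hΦm).2 hΦ2⟩, ?_⟩
  · refine m1.of_le key.locallyIntegrable.aestronglyMeasurable (Eventually.of_forall fun X => ?_)
    rw [recomposedAmplitude, norm_mul, norm_mul, norm_norm]
  · rw [key.integral_norm_weakGrad_sq, integral_eq_lintegral_of_nonneg_ae hnn (hΦm.norm.pow 2)]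
    refine ENNReal.toReal_le_of_le_ofReal ?_ hbound
    have := mollifierEnergy_nonneg (d := d)
    have : 0 ≤ ∫ x, ‖G x‖ ^ 2 := integral_nonneg fun x => by positivity
    positivity

end Recomposition

/-! ### The limit ε → 0: weak convergence and cost -/

section Limits

variable {N d : ℕ} {ε : ℝ} {ρ : Space d → ℝ} {P : ProbabilityMeasure (Config N d)}

theorem mollifiedDensity_congr {ρ' : Space d → ℝ} (h : ρ =ᵐ[volume] ρ') :
    mollifiedDensity ρ ε = mollifiedDensity ρ' ε := by
  ext y
  refine lintegral_congr_ae ?_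
  filter_upwards [h] with x hx
  rw [hx]

theorem recomposedPlanDensity_congr {ρ' : Space d → ℝ} (h : ρ =ᵐ[volume] ρ') :
    recomposedPlanDensity ρ P ε =ᵐ[volume] recomposedPlanDensity ρ' P ε := by
  have hi : ∀ᵐ X : Config N d, ∀ i, ρ (X i) = ρ' (X i) :=
    ae_all_iff.2 fun i => (Config.quasiMeasurePreserving_apply i).ae h
  filter_upwards [hi] with X hX
  simp only [recomposedPlanDensity, recompositionKernel, hX, mollifiedDensity_congr h]

theorem mem_transportPlans_congr {ρ' : Space d → ℝ} (h : ρ =ᵐ[volume] ρ') :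
    P ∈ transportPlans N ρ ↔ P ∈ transportPlans N ρ' := by
  have : (volume : Measure (Space d)).withDensity (fun x => ENNReal.ofReal (ρ x)) =
      volume.withDensity fun x => ENNReal.ofReal (ρ' x) :=
    withDensity_congr_ae (by filter_upwards [h] with x hx; rw [hx])
  simp only [transportPlans, Set.mem_ofPred_eq, this]

theorem isProbabilityMeasure_recomposed (hρ : Measurable ρ)
    (hρ1 : ∫⁻ x, ENNReal.ofReal (ρ x) = 1) (hP : P ∈ transportPlans N ρ) (hε : 0 < ε) :
    IsProbabilityMeasure ((volume : Measure (Config N d)).withDensity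
      (recomposedPlanDensity ρ P ε)) :=
  ⟨by rw [withDensity_apply _ MeasurableSet.univ, Measure.restrict_univ,
    lintegral_recomposedPlanDensity hρ hρ1 hP hε]⟩

theorem recomposed_mem_transportPlans (hρ : Measurable ρ)
    (hρ1 : ∫⁻ x, ENNReal.ofReal (ρ x) = 1) (hP : P ∈ transportPlans N ρ) (hε : 0 < ε)
    {Q : ProbabilityMeasure (Config N d)}
    (hQ : (Q : Measure (Config N d)) = volume.withDensity (recomposedPlanDensity ρ P ε)) :
    Q ∈ transportPlans N ρ := by
  intro i
  ext s hs
  have hi : Measurable (s.indicator fun _ => (1 : ℝ≥0∞)) := measurable_const.indicator hs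
  have hp : MeasurableSet ((fun X : Config N d => X i) ⁻¹' s) := Config.measurable_apply i hs
  rw [Measure.map_apply (Config.measurable_apply i) hs, hQ, withDensity_apply _ hp,
    withDensity_apply _ hs, ← lintegral_indicator hp, ← lintegral_indicator hs]
  have h := lintegral_recomposedPlanDensity_mul_apply hρ hρ1 hP hε hi i
  refine Eq.trans (lintegral_congr fun X => ?_) (h.trans (lintegral_congr fun x => ?_))
  · by_cases hX : X i ∈ s <;> simp [hX]
  · by_cases hx : x ∈ s <;> simp [hx]

theorem lintegral_recomposed_le (hρ : Measurable ρ) (hε : 0 < ε)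
    {Q : ProbabilityMeasure (Config N d)}
    (hQ : (Q : Measure (Config N d)) = volume.withDensity (recomposedPlanDensity ρ P ε))
    {f F : Config N d → ℝ≥0∞} (hf : Measurable f)
    (h : ∀ᵐ X ∂(P : Measure (Config N d)), ∀ X' : Config N d,
      (∀ i, ‖X' i - X i‖ < 2 * ε) → f X' ≤ F X) :
    ∫⁻ X, f X ∂(Q : Measure (Config N d)) ≤ ∫⁻ X, F X ∂(P : Measure (Config N d)) := by
  rw [hQ, lintegral_withDensity_eq_lintegral_mul _ (measurable_recomposedPlanDensity P hρ hε) hf]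
  exact lintegral_recomposedPlanDensity_mul_le hρ hε hf h

theorem Config.norm_sub_le {r : ℝ} (hr : 0 ≤ r) {X X' : Config N d}
    (h : ∀ i, ‖X' i - X i‖ ≤ r) : ‖X' - X‖ ≤ N * r := by
  have h1 : ‖X' - X‖ ^ 2 ≤ (N * r) ^ 2 := by
    rw [PiLp.norm_sq_eq_of_L2]
    calc ∑ i, ‖(X' - X) i‖ ^ 2 ≤ ∑ _i : Fin N, r ^ 2 :=
          Finset.sum_le_sum fun i _ => pow_le_pow_left₀ (norm_nonneg _) (h i) 2
      _ = N * r ^ 2 := by simp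
      -- The crude N ≤ N² replaces the sharp constant √N; only convergence of the radius to 0 is
      -- needed.
      _ ≤ (N * r) ^ 2 := by
          rw [mul_pow]
          gcongr
          exact_mod_cast Nat.le_self_pow two_ne_zero N
  exact le_of_sq_le_sq h1 (by positivity)

theorem recomposed_apply_le (hρ : Measurable ρ) (hε : 0 < ε)
    {Q : ProbabilityMeasure (Config N d)}
    (hQ : (Q : Measure (Config N d)) = volume.withDensity (recomposedPlanDensity ρ P ε))
    {s : Set (Config N d)} (hs : MeasurableSet s) :
    (Q : Measure (Config N d)) s ≤
      (P : Measure (Config N d)) (Metric.cthickening (N * (2 * ε)) s) := by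
  have h := lintegral_recomposed_le hρ hε hQ (f := s.indicator 1)
    (F := (Metric.cthickening (N * (2 * ε)) s).indicator 1) (measurable_one.indicator hs)
    (Eventually.of_forall fun X X' hX => ?_)
  · rwa [lintegral_indicator_one hs,
      lintegral_indicator_one Metric.isClosed_cthickening.measurableSet] at h
  · by_cases hX' : X' ∈ s
    · have : X ∈ Metric.cthickening (N * (2 * ε)) s := by
        refine Metric.mem_cthickening_of_dist_le X X' _ s hX' ?_
        rw [dist_comm, dist_eq_norm]
        exact Config.norm_sub_le (by positivity) fun i => (hX i).le
      simp [hX', this]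
    · simp [hX']

/-- Portmanteau criterion on closed sets F: the new mass of F is at most the `P`-mass of its closed
thickening of radius 2Nε, which decreases to `P(F)`. -/
theorem tendsto_recomposed (hρ : Measurable ρ) {Q : ℝ → ProbabilityMeasure (Config N d)}
    (hQ : ∀ ε, 0 < ε → (Q ε : Measure (Config N d)) =
      volume.withDensity (recomposedPlanDensity ρ P ε)) :
    Tendsto Q (𝓝[>] 0) (𝓝 P) := by
  refine tendsto_of_forall_isClosed_limsup_le' fun F hF => ?_
  have h1 : Tendsto (fun ε : ℝ => (N : ℝ) * (2 * ε)) (𝓝[>] 0) (𝓝 0) := by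
    have : Continuous fun ε : ℝ => (N : ℝ) * (2 * ε) := by fun_prop
    have h := this.tendsto 0
    simp only [mul_zero] at h
    exact h.mono_left nhdsWithin_le_nhds
  have h2 := (tendsto_measure_cthickening_of_isClosed (μ := (P : Measure (Config N d)))
    ⟨1, one_pos, measure_ne_top _ _⟩ hF).comp h1
  rw [← h2.limsup_eq]
  refine limsup_le_limsup ?_
  filter_upwards [self_mem_nhdsWithin] with ε hε
  exact recomposed_apply_le hρ hε (hQ ε hε) hF.measurableSet

theorem measurable_coulombCost : Measurable (coulombCost : Config N d → ℝ≥0∞) :=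
  Finset.measurable_fun_sum _ fun i _ => Finset.measurable_fun_sum _ fun j _ =>
    ((Config.measurable_apply i).sub (Config.measurable_apply j)).enorm.inv

theorem coulombCost_le {α : ℝ} (hα : 0 < α) (hε : 0 < ε) (hεα : 4 * ε < α) {X X' : Config N d}
    (hX : X ∉ diagStrip N d α) (h : ∀ i, ‖X' i - X i‖ < 2 * ε) :
    coulombCost X' ≤ ENNReal.ofReal ((1 - 4 * ε / α)⁻¹) * coulombCost X := by
  have hc : 0 < 1 - 4 * ε / α := by
    rw [sub_pos, div_lt_one hα]; exact hεα
  unfold coulombCost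
  simp only [Finset.mul_sum]
  refine Finset.sum_le_sum fun i _ => Finset.sum_le_sum fun j hj => ?_
  have hij : i ≠ j := (Finset.mem_Ioi.1 hj).ne
  have h1 : α ≤ ‖X i - X j‖ := by
    by_contra h0
    exact hX ⟨i, j, hij, not_le.1 h0⟩
  have h2 : (1 - 4 * ε / α) * ‖X i - X j‖ ≤ ‖X' i - X' j‖ := by
    have h3 : ‖X i - X j‖ ≤ ‖X' i - X i‖ + ‖X' i - X' j‖ + ‖X' j - X j‖ := by
      have : X i - X j = -(X' i - X i) + (X' i - X' j) + (X' j - X j) := by abel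
      rw [this]
      refine (norm_add₃_le).trans ?_
      rw [norm_neg]
    -- Two particles together lose at most 4ε of distance. Off the strip the distance is at least α,
    -- so the loss is proportional to the distance itself.
    have h4 : 4 * ε ≤ 4 * ε / α * ‖X i - X j‖ := by
      rw [div_mul_eq_mul_div, le_div_iff₀ hα]
      gcongr
    have := h i
    have := h j
    linarith
  rw [ENNReal.ofReal_inv_of_pos hc, ← ENNReal.mul_inv (Or.inl (by simpa using hc))
    (Or.inl ENNReal.ofReal_ne_top), ENNReal.inv_le_inv]
  rw [← ofReal_norm, ← ofReal_norm, ← ENNReal.ofReal_mul hc.le]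
  exact ENNReal.ofReal_le_ofReal h2

theorem limsup_transportCost_recomposed_le (hρ : Measurable ρ)
    {Q : ℝ → ProbabilityMeasure (Config N d)}
    (hQ : ∀ ε, 0 < ε → (Q ε : Measure (Config N d)) =
      volume.withDensity (recomposedPlanDensity ρ P ε)) {α : ℝ} (hα : 0 < α)
    (hPα : (P : Measure (Config N d)) (diagStrip N d α) = 0) :
    limsup (fun ε => transportCost (Q ε)) (𝓝[>] 0) ≤ transportCost P := by
  have h1 : Tendsto (fun ε : ℝ => ENNReal.ofReal ((1 - 4 * ε / α)⁻¹) * transportCost P)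
      (𝓝[>] 0) (𝓝 (transportCost P)) := by
    have h2 : Tendsto (fun ε : ℝ => (1 - 4 * ε / α)⁻¹) (𝓝 0) (𝓝 1) := by
      have : Tendsto (fun ε : ℝ => 1 - 4 * ε / α) (𝓝 0) (𝓝 1) := by
        have hc : Continuous fun ε : ℝ => 1 - 4 * ε / α := by fun_prop
        simpa using hc.tendsto 0
      simpa using this.inv₀ one_ne_zero
    have h3 := (ENNReal.tendsto_ofReal h2).mono_left (nhdsWithin_le_nhds (s := Set.Ioi 0))
    -- The factor has the nonzero limit 1, so multiplication is continuous even if the cost of `P`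
    -- is infinite.
    have h4 := ENNReal.Tendsto.mul_const (b := transportCost P) h3 (Or.inl (by simp))
    simpa using h4
  rw [← h1.limsup_eq]
  refine limsup_le_limsup ?_
  have hlt : ∀ᶠ ε in 𝓝[>] (0 : ℝ), ε < α / 4 :=
    nhdsWithin_le_nhds (Iio_mem_nhds (by positivity))
  filter_upwards [self_mem_nhdsWithin, hlt] with ε hε hεα
  have hae : ∀ᵐ X ∂(P : Measure (Config N d)), X ∉ diagStrip N d α :=
    measure_eq_zero_iff_ae_notMem.1 hPα
  rw [transportCost, transportCost, ← lintegral_const_mul _ measurable_coulombCost]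
  refine lintegral_recomposed_le hρ hε (hQ ε hε) measurable_coulombCost ?_
  filter_upwards [hae] with X hX X' hX'
  exact coulombCost_le hα hε (by linarith) hX hX'

end Limits

/-! ### Assembly -/

theorem proposition3p7 (d : ℕ) :
    ∃ K : ℝ, 0 < K ∧
      ∀ (N : ℕ) (ρ : Space d → ℝ), IsElectronDensity ρ →
      ∀ P ∈ transportPlans N ρ, ∀ α : ℝ, 0 < α →
        (P : Measure (Config N d)) (diagStrip N d α) = 0 →
        ∃ (Pε : ℝ → ProbabilityMeasure (Config N d)) (φ : ℝ → Config N d → ℝ),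
          (∀ ε : ℝ, 0 < ε →
            Pε ε ∈ transportPlans N ρ ∧
            MemH1 (φ ε) ∧
            (Pε ε : Measure (Config N d)) =
              volume.withDensity (fun X => ENNReal.ofReal (φ ε X ^ 2)) ∧
            (Pε ε : Measure (Config N d)) =
              volume.withDensity (recomposedPlanDensity ρ P ε) ∧
            ∫ X, ‖weakGrad (φ ε) X‖ ^ 2 ≤
              (N : ℝ) * (h1NormSq (fun x => √(ρ x)) + K / (4 * ε ^ 2))) ∧
          Tendsto Pε (𝓝[>] 0) (𝓝 P) ∧
          limsup (fun ε => transportCost (Pε ε)) (𝓝[>] 0) ≤ transportCost P := by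
  have hE := mollifierEnergy_nonneg (d := d)
  -- The 4 compensates for the 4 in K/(4ε²). The added 1 makes K positive when only nonnegativity of
  -- the energy is known.
  refine ⟨4 * mollifierEnergy d + 1, by positivity, fun N ρ₀ hρ₀ P hP₀ α hα hPα => ?_⟩
  have hint : Integrable ρ₀ := by
    by_contra h
    have := hρ₀.integral_eq_one
    rw [integral_undef h] at this
    exact zero_ne_one this
  -- Everything is carried out for a Borel representative of the density. The plans, weak gradients
  -- and recomposed measure do not see the change.
  obtain ⟨ρ, hρ, hρρ⟩ : ∃ ρ : Space d → ℝ, Measurable ρ ∧ ρ₀ =ᵐ[volume] ρ :=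
    hint.aestronglyMeasurable.aemeasurable
  have hρ1 : ∫⁻ x, ENNReal.ofReal (ρ x) = 1 := by
    have h1 : ∫⁻ x, ENNReal.ofReal (ρ x) = ∫⁻ x, ENNReal.ofReal (ρ₀ x) :=
      lintegral_congr_ae (by filter_upwards [hρρ] with x hx; rw [hx])
    rw [h1, ← ofReal_integral_eq_lintegral_ofReal hint hρ₀.nonneg, hρ₀.integral_eq_one]
    simp
  obtain ⟨-, G₀, hw₀, hG₀⟩ := hρ₀.sqrt_memH1
  obtain ⟨G, hG, hGG⟩ : ∃ G : Space d → Space d, Measurable G ∧ G₀ =ᵐ[volume] G :=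
    hG₀.aestronglyMeasurable.aemeasurable
  have hw : HasWeakGradient (fun x => √(ρ x)) G :=
    hw₀.congr (by filter_upwards [hρρ] with x hx; rw [hx]) hGG
  have hG2 : MemLp G 2 volume := hG₀.ae_eq hGG
  have hP : P ∈ transportPlans N ρ := (mem_transportPlans_congr hρρ).1 hP₀
  -- The energy estimate needs only the gradient part; the nonnegative L² part is given away.
  have hnorm : ∫ x, ‖G x‖ ^ 2 ≤ h1NormSq (fun x => √(ρ₀ x)) := by
    rw [h1NormSq, (hw₀.congr ae_eq_rfl hGG).integral_norm_weakGrad_sq]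
    have : 0 ≤ ∫ x, √(ρ₀ x) ^ 2 := integral_nonneg fun x => by positivity
    linarith
  let Q : ℝ → ProbabilityMeasure (Config N d) := fun ε => if hε : 0 < ε then
    ⟨volume.withDensity (recomposedPlanDensity ρ P ε),
      isProbabilityMeasure_recomposed hρ hρ1 hP hε⟩ else P
  have hQ : ∀ ε, 0 < ε → (Q ε : Measure (Config N d)) =
      volume.withDensity (recomposedPlanDensity ρ P ε) := fun ε hε => by
    have : Q ε = ⟨volume.withDensity (recomposedPlanDensity ρ P ε),
      isProbabilityMeasure_recomposed hρ hρ1 hP hε⟩ := dif_pos hε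
    rw [this]
    rfl
  refine ⟨Q, fun ε => recomposedAmplitude ρ P ε, fun ε hε => ?_, tendsto_recomposed hρ hQ,
    limsup_transportCost_recomposed_le hρ hQ hα hPα⟩
  obtain ⟨hH1, hen⟩ := recomposedAmplitude_spec hρ hρ1 hP hε hG hw hG2
  refine ⟨(mem_transportPlans_congr hρρ).2 (recomposed_mem_transportPlans hρ hρ1 hP hε (hQ ε hε)),
    hH1, ?_, ?_, hen.trans ?_⟩
  · rw [hQ ε hε]
    exact withDensity_congr_ae (ofReal_recomposedAmplitude_sq hρ hρ1 hP hε).symm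
  · rw [hQ ε hε]
    exact withDensity_congr_ae (recomposedPlanDensity_congr hρρ).symm
  · have h1 : mollifierEnergy d / ε ^ 2 ≤ (4 * mollifierEnergy d + 1) / (4 * ε ^ 2) := by
      rw [div_le_div_iff₀ (by positivity) (by positivity)]
      nlinarith [sq_nonneg ε]
    gcongr
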